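/- Let $C[0,1]$ be the Banach space of real continuous functions on $[0,1]$ with the supremum norm $\|\cdot\|$ and its Borel $\sigma$-algebra. **Smoothly dense sets.** Write $\langle x\rangle=x-\lfloor x\rfloor$. For $f,g\in C[0,1]$ let $\mathsf{cr}(f,g)=\{t\in[0,1]:\langle f(t)\rangle=\langle g(t)\rangle\}$. For finite $A,B\subset[0,1]$ and $\epsilon>0$ write $A\sim_\epsilon B$ if $|A|=|B|$ and, when both sets are listed in increasing order, the $i$-th element of $A$ and the $i$-th element of $B$ are at distance less than $\epsilon$, for every $i$. A set $\mathcal F\subseteq C[0,1]$ is *transverse* if (1) $\mathsf{cr}(f,g)\cap\mathsf{cr}(h,k)=\emptyset$ whenever $\{f,g\}\neq\{h,k\}$ are two different two-element subsets of $\mathcal F$; and (2) for all distinct $f,g\in\mathcal F$, the set $\mathsf{cr}(f,g)$ is finite, does not contain $0$ or $1$, and no $t\in\mathsf{cr}(f,g)$ is a local extremum of $f-g$. A countable set $V\subseteq C[0,1]$ is *smoothly dense* if 1. $V$ is dense in $C[0,1]$; 2. $V$ is transverse; 3. every $f\in V$ is Lipschitz on $[0,1]$; 4. for every finite $\mathcal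 F\subset V$, every $f\in C[0,1]\setminus\mathcal F$ such that $\mathcal F\cup\{f\}$ is transverse, and every $\epsilon>0$, there is $g\in V$ (a smooth $\epsilon$-approximation of $f$ relative to $\mathcal F$) with $\|f-g\|<\epsilon$ and $\mathsf{cr}(f,h)\sim_\epsilon\mathsf{cr}(g,h)$ for all $h\in\mathcal F$. **Random piecewise linear functions.** For $n\in\mathbb N_0$, a sequence $(x_i)_{i\ge0}$ of distinct points of $(0,1)$ and a real sequence $(y_i)_{i\ge0}$, let $\Phi(n,(x_i),(y_i))\in C[0,1]$ be the function whose graph consists of the line segments joining consecutive points of $(0,y_0),(\hat x_1,y_1),\dots,(\hat x_n,y_n),(1,y_{n+1})$, where $\hat x_1<\dots<\hat x_n$ is the increasing enumeration of $\{x_1,\dots,x_n\}$. Let $\mathbb P$ be the probability measure on $\mathbb N_0\times[0,1]^{\mathbb N_0}\times\mathbb R^{\mathbb N_0}$ under which all coordinates are independent, $n$ is Poisson with mean $1$, each $x_i$ is uniform on $[0,1]$ and each $y_i$ is standard normal. Then $\Phi$ is defined $\mathbb P$-almost everywhere and measurable; let $\mathbb P_{\mathsf{PL}}=\mathbb P\circ\Phi^{-1}$,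 a probability measure on $C[0,1]$. **Theorem.** For $\mathbb P_{\mathsf{PL}}^{\mathbb N}$-almost every sequence $(f_n)_{n\in\mathbb N}$ in $C[0,1]$, the set $V=\{f_1,f_2,\dots\}$ is smoothly dense. -/

import Mathlib

open MeasureTheory ProbabilityTheory Set

namespace SmoothlyDense

/-- The Banach space `C[0,1]` with the supremum norm. -/
abbrev C01 : Type := C(unitInterval, ℝ)

/-- `C[0,1]` carries its Borel σ-algebra. -/
instance instMeasurableSpaceC01 : MeasurableSpace C01 := borel C01

instance instBorelSpaceC01 : BorelSpace C01 := ⟨rfl⟩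

/-! ### Crossings, transverse sets, smoothly dense sets -/

/-- The crossing set of `f` and `g`: the points at which their fractional parts agree. -/
def cr (f g : C01) : Set unitInterval := {t | Int.fract (f t) = Int.fract (g t)}

/-- `A ∼_ε B`: both sets are finite with the same number of elements, and when they are
enumerated in increasing order, corresponding elements are less than `ε` apart. -/
def CloseSets (ε : ℝ) (A B : Set unitInterval) : Prop :=
  ∃ (k : ℕ) (a b : Fin k → unitInterval), StrictMono a ∧ StrictMono b ∧
    range a = A ∧ range b = B ∧ ∀ i, |(a i : ℝ) - (b i : ℝ)| < ε

/-- Transverse sets of functions. Pairs are unordered pairs of two distinct members. -/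
structure Transverse (F : Set C01) : Prop where
  /-- Crossing sets of distinct pairs are disjoint. -/
  disjoint_cr : ∀ f ∈ F, ∀ g ∈ F, ∀ h ∈ F, ∀ k ∈ F, f ≠ g → h ≠ k →
    s(f, g) ≠ s(h, k) → Disjoint (cr f g) (cr h k)
  finite_cr : ∀ f ∈ F, ∀ g ∈ F, f ≠ g → (cr f g).Finite
  zero_notMem : ∀ f ∈ F, ∀ g ∈ F, f ≠ g → (0 : unitInterval) ∉ cr f g
  one_notMem : ∀ f ∈ F, ∀ g ∈ F, f ≠ g → (1 : unitInterval) ∉ cr f g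
  not_isLocalExtr : ∀ f ∈ F, ∀ g ∈ F, f ≠ g → ∀ t ∈ cr f g,
    ¬ IsLocalExtr (fun s : unitInterval => f s - g s) t

/-- `g` is a smooth `ε`-approximation of `f` relative to `F`. -/
def IsSmoothApprox (ε : ℝ) (F : Set C01) (f g : C01) : Prop :=
  ‖f - g‖ < ε ∧ ∀ h ∈ F, CloseSets ε (cr f h) (cr g h)

/-- Smoothly dense subsets of `C[0,1]`. -/
structure IsSmoothlyDense (V : Set C01) : Prop where
  countable : V.Countable
  dense : Dense V
  transverse : Transverse V
  lipschitz : ∀ f ∈ V, ∃ K : NNReal, LipschitzWith K f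
  exists_smoothApprox : ∀ F : Set C01, F.Finite → F ⊆ V → ∀ f : C01, f ∉ F →
    Transverse (insert f F) → ∀ ε : ℝ, 0 < ε → ∃ g ∈ V, IsSmoothApprox ε F f g

/-! ### Random piecewise linear functions -/

/-- The order statistics (increasing rearrangement) of a finite tuple. -/
noncomputable def orderStat {n : ℕ} (x : Fin n → unitInterval) : Fin n → unitInterval :=
  x ∘ Tuple.sort x

/-- The abscissas of the change points: `knot n x 0 = 0`; for `1 ≤ i ≤ n`, `knot n x i` is the
`i`-th element, in increasing order, of `x 1, …, x n`; and `knot n x (n + 1) = 1`. -/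
noncomputable def knot (n : ℕ) (x : ℕ → unitInterval) : ℕ → ℝ
  | 0 => 0
  | i + 1 => if h : i < n then (orderStat (fun j : Fin n => x (j + 1)) ⟨i, h⟩ : ℝ) else 1

/-- The value at `t` of the function whose graph consists of the line segments joining the
consecutive change points `(knot n x i, y i)`, `0 ≤ i ≤ n + 1`. The `i`-th summand is the
increment along the part of the `i`-th segment that lies to the left of `t`. -/
noncomputable def plValue (n : ℕ) (x : ℕ → unitInterval) (y : ℕ → ℝ) (t : ℝ) : ℝ :=
  y 0 + ∑ i ∈ Finset.range (n + 1),
    (y (i + 1) - y i) * max 0 (min 1 ((t - knot n x i) / (knot n x (i + 1) - knot n x i)))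

theorem continuous_plValue (n : ℕ) (x : ℕ → unitInterval) (y : ℕ → ℝ) :
    Continuous (plValue n x y) := by
  unfold plValue
  fun_prop

/-- The knots are increasing. -/
theorem knot_le_succ (n : ℕ) (x : ℕ → unitInterval) (i : ℕ) : knot n x i ≤ knot n x (i + 1) := by
  cases i with
  | zero =>
    simp only [knot]
    split_ifs
    · exact (orderStat _ _).2.1
    · exact zero_le_one
  | succ i =>
    simp only [knot]
    split_ifs with h1 h2 h2
    · exact Tuple.monotone_sort (fun j : Fin n => x (j + 1)) (by simp)
    · exact (orderStat _ _).2.2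
    · omega
    · exact le_rfl

theorem knot_mono (n : ℕ) (x : ℕ → unitInterval) : Monotone (knot n x) :=
  monotone_nat_of_le_succ (knot_le_succ n x)

/-- If the knots are pairwise distinct, then on each interval between consecutive knots the graph
of `plValue n x y` is the line segment joining the two change points. -/
theorem plValue_eq_segment (n : ℕ) (x : ℕ → unitInterval) (y : ℕ → ℝ)
    (hx : ∀ i ≤ n, knot n x i < knot n x (i + 1)) (m : ℕ) (hm : m ≤ n) (t : ℝ)
    (h1 : knot n x m ≤ t) (h2 : t ≤ knot n x (m + 1)) :
    plValue n x y t =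
      y m + (y (m + 1) - y m) * ((t - knot n x m) / (knot n x (m + 1) - knot n x m)) := by
  have key : ∀ i ∈ Finset.range (n + 1),
      (y (i + 1) - y i) * max 0 (min 1 ((t - knot n x i) / (knot n x (i + 1) - knot n x i))) =
      (if i < m then y (i + 1) - y i else 0) + (if i = m then
        (y (m + 1) - y m) * ((t - knot n x m) / (knot n x (m + 1) - knot n x m)) else 0) := by
    intro i hi
    have hi' : i ≤ n := Nat.lt_succ_iff.1 (Finset.mem_range.1 hi)
    have hpos := sub_pos.2 (hx i hi')
    rcases lt_trichotomy i m with h | h | h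
    · have h3 : knot n x (i + 1) ≤ t := (knot_mono n x h).trans h1
      have h4 : 1 ≤ (t - knot n x i) / (knot n x (i + 1) - knot n x i) := by
        rw [one_le_div hpos]
        linarith
      simp [h, h.ne, min_eq_left h4]
    · subst h
      have h3 : (t - knot n x i) / (knot n x (i + 1) - knot n x i) ≤ 1 := by
        rw [div_le_one hpos]
        linarith
      have h4 : 0 ≤ (t - knot n x i) / (knot n x (i + 1) - knot n x i) :=
        div_nonneg (by linarith) hpos.le
      simp [min_eq_right h3, max_eq_right h4]
    · have h3 : t ≤ knot n x i := h2.trans (knot_mono n x h)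
      have h4 : (t - knot n x i) / (knot n x (i + 1) - knot n x i) ≤ 0 :=
        div_nonpos_of_nonpos_of_nonneg (by linarith) hpos.le
      have h5 := max_eq_left ((min_le_right 1 _).trans h4)
      simp [h5, not_lt.2 h.le, h.ne']
  unfold plValue
  rw [Finset.sum_congr rfl key, Finset.sum_add_distrib, Finset.sum_ite_eq' (Finset.range (n + 1)) m,
    if_pos (Finset.mem_range.2 (by omega)), ← Finset.sum_filter]
  have hf : (Finset.range (n + 1)).filter (fun i => i < m) = Finset.range m := by
    ext i
    simp only [Finset.mem_filter, Finset.mem_range]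
    omega
  rw [hf, Finset.sum_range_sub]
  ring

/-- The parameter space: a number `n`, positions `x 0, x 1, …` and values `y 0, y 1, …`. -/
abbrev Param : Type := ℕ × (ℕ → unitInterval) × (ℕ → ℝ)

/-- The piecewise linear function determined by a parameter. -/
noncomputable def plFun (p : Param) : C01 where
  toFun t := plValue p.1 p.2.1 p.2.2 t
  continuous_toFun := (continuous_plValue p.1 p.2.1 p.2.2).comp continuous_subtype_val

/-- A map into `C[0,1]` is measurable as soon as all its evaluations are. -/
theorem measurable_of_eval {X : Type*} [MeasurableSpace X] {Φ : X → C01}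
    (h : ∀ t : unitInterval, Measurable fun p => Φ p t) : Measurable Φ := by
  refine measurable_of_isOpen fun U hU => ?_
  obtain ⟨D, hDc, hDd⟩ := TopologicalSpace.exists_countable_dense unitInterval
  obtain ⟨E, hEc, hEd⟩ := TopologicalSpace.exists_countable_dense C01
  have hball : ∀ (g : C01) (r : ℝ), MeasurableSet (Φ ⁻¹' Metric.closedBall g r) := by
    intro g r
    by_cases hr : 0 ≤ r
    · have : Φ ⁻¹' Metric.closedBall g r = ⋂ t ∈ D, {p | dist (Φ p t) (g t) ≤ r} := by
        ext p
        simp only [mem_preimage, Metric.mem_closedBall, mem_iInter, mem_ofPred_eq]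
        rw [ContinuousMap.dist_le hr]
        refine ⟨fun H t _ => H t, fun H => ?_⟩
        have hcl : IsClosed {t : unitInterval | dist (Φ p t) (g t) ≤ r} :=
          isClosed_le (by fun_prop) continuous_const
        intro t
        exact hcl.closure_subset_iff.2 (fun t ht => H t ht) (hDd t)
      rw [this]
      exact MeasurableSet.biInter hDc fun t _ =>
        measurableSet_le ((h t).dist measurable_const) measurable_const
    · rw [Metric.closedBall_eq_empty.2 (not_le.1 hr)]
      simp
  have hU' : U = ⋃ g ∈ E, ⋃ q : {q : ℚ // Metric.closedBall g (q : ℝ) ⊆ U},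
      Metric.closedBall g ((q : ℚ) : ℝ) := by
    apply Subset.antisymm
    · intro f hf
      obtain ⟨r, hr, hrU⟩ := Metric.isOpen_iff.1 hU f hf
      obtain ⟨q, hq0, hq⟩ := exists_rat_btwn (show (0 : ℝ) < r / 2 by linarith)
      obtain ⟨g, hgE, hg⟩ := hEd.exists_dist_lt f hq0
      simp only [mem_iUnion]
      refine ⟨g, hgE, ⟨q, fun k hk => hrU ?_⟩, ?_⟩
      · rw [Metric.mem_ball]
        rw [Metric.mem_closedBall] at hk
        have := dist_triangle k g f
        rw [dist_comm g f] at this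
        linarith
      · exact Metric.mem_closedBall.2 hg.le
    · simp only [iUnion_subset_iff]
      exact fun g _ q => q.2
  rw [hU', preimage_iUnion₂]
  refine MeasurableSet.biUnion hEc fun g _ => ?_
  rw [preimage_iUnion]
  exact MeasurableSet.iUnion fun q => hball g _

theorem measurable_orderStat {n : ℕ} (i : Fin n) :
    Measurable fun x : Fin n → unitInterval => orderStat x i := by
  refine measurable_of_Iic fun c => ?_
  have : (fun x : Fin n → unitInterval => orderStat x i) ⁻¹' Iic c =
      ⋃ s : Finset (Fin n), ⋃ _ : (i : ℕ) < s.card, ⋂ j ∈ s, {x | x j ≤ c} := by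
    ext x
    simp only [mem_preimage, mem_Iic, mem_iUnion, mem_iInter, mem_ofPred_eq, exists_prop]
    have hcard : (Finset.univ.filter fun j => orderStat x j ≤ c).card =
        (Finset.univ.filter fun j => x j ≤ c).card :=
      Finset.card_bij (fun j _ => Tuple.sort x j) 
        (fun a ha => by
          rw [Finset.mem_filter] at ha ⊢
          exact ⟨Finset.mem_univ _, ha.2⟩)
        (by simp)
        fun b hb => ⟨(Tuple.sort x).symm b, by
          rw [Finset.mem_filter] at hb ⊢
          exact ⟨Finset.mem_univ _, by simpa [orderStat] using hb.2⟩, by simp⟩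
    rw [← Tuple.lt_card_le_iff_apply_le_of_monotone (show Monotone (orderStat x) from
      Tuple.monotone_sort x), hcard]
    constructor
    · exact fun hi => ⟨_, hi, by simp⟩
    · rintro ⟨s, hs, hsc⟩
      exact hs.trans_le (Finset.card_le_card fun j hj => by simpa using hsc j hj)
  rw [this]
  exact MeasurableSet.iUnion fun s => MeasurableSet.iUnion fun _ =>
    Finset.measurableSet_biInter s fun j _ => measurableSet_le (measurable_pi_apply j)
      measurable_const

theorem measurable_knot (n i : ℕ) : Measurable fun x : ℕ → unitInterval => knot n x i := by
  cases i with
  | zero => exact measurable_const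
  | succ i =>
    simp only [knot]
    split_ifs with h
    · have hm : Measurable fun (x : ℕ → unitInterval) (j : Fin n) => x (j + 1) :=
        measurable_pi_lambda _ fun j => measurable_pi_apply _
      exact measurable_subtype_coe.comp ((measurable_orderStat ⟨i, h⟩).comp hm)
    · exact measurable_const

theorem measurable_plFun : Measurable plFun := by
  refine measurable_of_eval fun t => measurable_from_prod_countable_right fun n => ?_
  have hk : ∀ i, Measurable fun p : (ℕ → unitInterval) × (ℕ → ℝ) => knot n p.1 i :=
    fun i => (measurable_knot n i).comp measurable_fst
  have hy : ∀ i, Measurable fun p : (ℕ → unitInterval) × (ℕ → ℝ) => p.2 i :=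
    fun i => (measurable_pi_apply i).comp measurable_snd
  change Measurable fun p : (ℕ → unitInterval) × (ℕ → ℝ) => plValue n p.1 p.2 t
  unfold plValue
  exact (hy 0).add (Finset.measurable_sum _ fun i _ => ((hy (i + 1)).sub (hy i)).mul
    (measurable_const.max (measurable_const.min
      ((measurable_const.sub (hk i)).div ((hk (i + 1)).sub (hk i))))))

/-- The law of the parameters: `n` is Poisson with mean `1`, the positions are uniform on `[0,1]`,
the values are standard normal, and all of these are independent. -/
noncomputable def paramMeasure : Measure Param :=
  (poissonMeasure 1).prod
    ((Measure.infinitePi fun _ : ℕ => (volume : Measure unitInterval)).prod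
      (Measure.infinitePi fun _ : ℕ => gaussianReal 0 1))

instance instIsProbabilityMeasureParamMeasure : IsProbabilityMeasure paramMeasure := by
  unfold paramMeasure
  infer_instance

/-- The law `P_PL` on `C[0,1]` of a random piecewise linear function. -/
noncomputable def plMeasure : Measure C01 := paramMeasure.map plFun

instance instIsProbabilityMeasurePlMeasure : IsProbabilityMeasure plMeasure :=
  Measure.isProbabilityMeasure_map measurable_plFun.aemeasurable

end SmoothlyDense

/-! The argument runs on sequences of independent parameters. Two almost sure properties of such a
sequence suffice, transversality and visits to every `gridBox`; the rest is deterministic.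

Transversality rests on the absence of atoms. At a fixed point the value of a random piecewise
linear function is a nonzero linear form in independent Gaussians. Resampling one function therefore
shows that its difference to another is almost surely not an integer at any of countably many points
chosen independently of it. For rational points and for the knots this is `ae_generalPosition`: near
a crossing the difference is then affine, and its slope is nonzero, since otherwise an integer would
also be attained at a rational point. Hence crossings are finite in number, avoid `0` and `1`, and
are not local extrema. Applied to the finite set of crossings of two functions, the same principle
makes different crossing sets disjoint (`ae_disjoint_cr`).

For smooth approximation, let `L` be a common Lipschitz constant of the finite family `F`. The
function `f` may cross a member of `F` so flatly that nearby functions cross it several times. So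
`f` is first replaced by `f₁`, which has the same crossings but passes through them with relative
slope `±(2 * L + 2)` (`exists_steepModification`). The sign change of the difference at a crossing,
available because crossings are not local extrema, ensures that no crossing is added. Near these
points `f₁` itself has slope at least `L + 2` up to sign. Piecewise linear functions with a fine,
almost equidistant grid and values close to those of `f₁` retain slope `L + 1`, so they cross each
member of `F` exactly once near each old crossing. Elsewhere compactness keeps them off all integer
translates. Thus a whole box of parameters gives smooth approximations. Boxes have positive
probability and countably many of them suffice, so the sequence visits them all.

Smooth density is not shown to be a measurable property, and `ae_map_of_ae` transfers it to the law
on `C[0,1]` nevertheless. -/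

namespace SmoothlyDense

/-! ### Image measures, resampling a coordinate, recurrence -/

section General

open Filter Topology

/-- Under a measurable map between Polish spaces, a property of the image points that holds almost
everywhere upstairs holds almost everywhere for the image measure; the property itself is not
required to be measurable. -/
theorem ae_map_of_ae {α β : Type*} [TopologicalSpace α] [hα : PolishSpace α] [MeasurableSpace α]
    [BorelSpace α] [TopologicalSpace β] [T2Space β] [SecondCountableTopology β]
    [MeasurableSpace β] [BorelSpace β] (μ : Measure α) [IsProbabilityMeasure μ] {φ : α → β}
    (hφ : Measurable φ) {P : β → Prop} (h : ∀ᵐ a ∂μ, P (φ a)) : ∀ᵐ b ∂(μ.map φ), P b := by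
  -- A finer Polish topology makes `φ` continuous without changing the Borel sets. Inner regularity
  -- then exhausts the good event by `τ`-compact sets, whose images are compact, hence closed and
  -- measurable.
  obtain ⟨τ, hle, hcont, hpol⟩ := hφ.exists_continuous
  have hB : @BorelSpace α τ _ := by
    refine @BorelSpace.mk α τ _ ?_
    rw [borel_eq_borel_of_le hpol hα hle]
    exact BorelSpace.measurable_eq
  obtain ⟨E, hEs, hEm, hE0⟩ := exists_measurable_superset_of_null (ae_iff.1 h)
  have hcompl : μ Eᶜ = 1 := by rw [prob_compl_eq_one_iff hEm, hE0]
  have hinner : ∀ n : ℕ, ∃ K ⊆ Eᶜ, @IsCompact α τ K ∧ 1 - (n + 1 : ENNReal)⁻¹ < μ K := by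
    intro n
    let _ := τ
    refine hEm.compl.exists_lt_isCompact (μ := μ) ?_
    rw [hcompl]
    exact ENNReal.sub_lt_self (by simp) (by simp) (by simp)
  choose K hKE hKc hK using hinner
  have hcl : ∀ n, MeasurableSet (φ '' K n) := fun n => by
    let _ := τ
    exact ((hKc n).image hcont).isClosed.measurableSet
  have hfull : μ.map φ (⋃ n, φ '' K n)ᶜ = 0 := by
    have := Measure.isProbabilityMeasure_map (μ := μ) hφ.aemeasurable
    rw [prob_compl_eq_zero_iff (MeasurableSet.iUnion hcl)]
    refine le_antisymm prob_le_one ?_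
    have hlow : ∀ n : ℕ, 1 - (n + 1 : ENNReal)⁻¹ ≤ μ.map φ (⋃ n, φ '' K n) := fun n => by
      rw [Measure.map_apply hφ (MeasurableSet.iUnion hcl)]
      refine (hK n).le.trans (measure_mono fun a ha => ?_)
      exact mem_iUnion.2 ⟨n, mem_image_of_mem φ ha⟩
    have hlim : Tendsto (fun n : ℕ => (1 : ENNReal) - (n + 1 : ENNReal)⁻¹) atTop (𝓝 (1 - 0)) := by
      refine ENNReal.Tendsto.sub tendsto_const_nhds ?_ (Or.inl ENNReal.one_ne_top)
      have := (tendsto_add_atTop_iff_nat 1).2 ENNReal.tendsto_inv_nat_nhds_zero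
      simpa using this
    rw [tsub_zero] at hlim
    exact le_of_tendsto' hlim hlow
  refine measure_mono_null (t := (⋃ n, φ '' K n)ᶜ) (fun b hb hb' => hb ?_) hfull
  obtain ⟨n, a, ha, rfl⟩ := mem_iUnion.1 hb'
  by_contra hP
  exact hKE n ha (hEs hP)

variable {ι : Type*} {X : ι → Type*} [∀ i, MeasurableSpace (X i)]

theorem map_update_infinitePi [DecidableEq ι] (μ : (i : ι) → Measure (X i))
    [∀ i, IsProbabilityMeasure (μ i)] (l : ι) :
    ((Measure.infinitePi μ).prod (μ l)).map (fun z => Function.update z.1 l z.2) =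
      Measure.infinitePi μ := by
  refine Measure.eq_infinitePi _ fun s t ht => ?_
  rw [Measure.map_apply measurable_update' (MeasurableSet.pi s.countable_toSet fun i _ => ht i)]
  by_cases hl : l ∈ s
  · have : (fun z : (∀ i, X i) × X l => Function.update z.1 l z.2) ⁻¹' (s : Set ι).pi t =
        ((s.erase l : Finset ι) : Set ι).pi t ×ˢ t l := by
      ext ⟨x, a⟩
      simp only [mem_preimage, Set.mem_pi, Finset.mem_coe, mem_prod, Finset.mem_erase]
      constructor
      · exact fun H => ⟨fun i hi => by simpa [hi.1] using H i hi.2, by simpa using H l hl⟩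
      · rintro ⟨H1, H2⟩ i hi
        by_cases hil : i = l
        · subst hil
          simpa using H2
        · simpa [hil] using H1 i ⟨hil, hi⟩
    rw [this, Measure.prod_prod, Measure.infinitePi_pi _ fun i _ => ht i, mul_comm,
      Finset.mul_prod_erase s (fun i => μ i (t i)) hl]
  · have : (fun z : (∀ i, X i) × X l => Function.update z.1 l z.2) ⁻¹' (s : Set ι).pi t =
        (s : Set ι).pi t ×ˢ univ := by
      ext ⟨x, a⟩
      simp only [mem_preimage, Set.mem_pi, Finset.mem_coe, mem_prod, mem_univ, and_true]
      refine forall₂_congr fun i hi => ?_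
      have hil : i ≠ l := fun h => hl (h ▸ hi)
      rw [Function.update_of_ne hil]
    rw [this, Measure.prod_prod, Measure.infinitePi_pi _ fun i _ => ht i, measure_univ, mul_one]

/-- Resampling one coordinate: a measurable property of a family of independent variables holds
almost surely if it does so after the `l`-th variable is replaced by an independent copy. -/
theorem ae_infinitePi_of_ae_update [DecidableEq ι] (μ : (i : ι) → Measure (X i))
    [∀ i, IsProbabilityMeasure (μ i)] (l : ι) {Q : (∀ i, X i) → Prop}
    (hQ : MeasurableSet {x | Q x})
    (h : ∀ᵐ x ∂(Measure.infinitePi μ), ∀ᵐ a ∂(μ l), Q (Function.update x l a)) :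
    ∀ᵐ x ∂(Measure.infinitePi μ), Q x := by
  rw [← map_update_infinitePi μ l, ae_map_iff measurable_update'.aemeasurable hQ]
  exact (Measure.ae_prod_iff_ae_ae (measurable_update' hQ)).2 h

/-- An independent sequence almost surely visits a given set of positive probability. -/
theorem ae_exists_mem_of_measure_ne_zero {Y : Type*} [MeasurableSpace Y] (μ : Measure Y)
    [IsProbabilityMeasure μ] {U : Set Y} (hU : MeasurableSet U) (h0 : μ U ≠ 0) :
    ∀ᵐ y ∂(Measure.infinitePi fun _ : ℕ => μ), ∃ l, y l ∈ U := by
  have hlt : μ Uᶜ < 1 := by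
    refine lt_of_le_of_ne prob_le_one fun h => h0 ?_
    rwa [prob_compl_eq_one_iff hU] at h
  have hle : ∀ N : ℕ, Measure.infinitePi (fun _ : ℕ => μ) {y | ¬ ∃ l, y l ∈ U} ≤ (μ Uᶜ) ^ N := by
    intro N
    refine (measure_mono (t := ((Finset.range N : Finset ℕ) : Set ℕ).pi fun _ => Uᶜ) ?_).trans ?_
    · intro y hy i _ hi
      exact hy ⟨i, hi⟩
    · rw [Measure.infinitePi_pi _ fun _ _ => hU.compl]
      simp
  exact le_antisymm (ge_of_tendsto' (ENNReal.tendsto_pow_atTop_nhds_zero_of_lt_one hlt) hle)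
    zero_le

end General

/-! ### Values of random piecewise linear functions have no atoms -/

/-- Resampling the `j`-th coordinate makes `ℓ` a nonconstant affine function of a Gaussian variable,
so a single value of that variable is bad, and it has probability zero. -/
theorem ae_linear_ne (ℓ : (ℕ → ℝ) →ₗ[ℝ] ℝ) (hℓ : Measurable ℓ) {j : ℕ}
    (hj : ℓ (Pi.single j 1) ≠ 0) (a : ℝ) :
    ∀ᵐ y ∂(Measure.infinitePi fun _ : ℕ => gaussianReal 0 1), ℓ y ≠ a := by
  refine ae_infinitePi_of_ae_update _ j (hℓ (measurableSet_singleton a)).compl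
    (Filter.Eventually.of_forall fun y => ?_)
  have hsplit : ∀ v : ℝ, ℓ (Function.update y j v) =
      ℓ (Function.update y j 0) + v * ℓ (Pi.single j 1) := by
    intro v
    have : Function.update y j v = Function.update y j 0 + v • (Pi.single j 1 : ℕ → ℝ) := by
      ext i
      by_cases hi : i = j
      · subst hi; simp
      · simp [hi]
    rw [this, map_add, map_smul, smul_eq_mul]
  have := nullSingletonClass_gaussianReal (μ := 0) (v := 1) one_ne_zero
  refine measure_mono_null (t := {(a - ℓ (Function.update y j 0)) / ℓ (Pi.single j 1)})
    (fun v hv => ?_) (measure_singleton _)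
  simp only [ne_eq, mem_compl_iff, mem_ofPred_eq, not_not] at hv
  rw [mem_singleton_iff, eq_div_iff hj, ← hv, hsplit v]
  ring

/-- For fixed knots and fixed `t`, the value `plValue n x y t` is linear in `y`. -/
noncomputable def plValueLinear (n : ℕ) (x : ℕ → unitInterval) (t : ℝ) : (ℕ → ℝ) →ₗ[ℝ] ℝ where
  toFun y := plValue n x y t
  map_add' y z := by
    simp only [plValue, Pi.add_apply]
    have : ∀ i ∈ Finset.range (n + 1),
        (y (i + 1) + z (i + 1) - (y i + z i)) *
          max 0 (min 1 ((t - knot n x i) / (knot n x (i + 1) - knot n x i))) =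
        (y (i + 1) - y i) * max 0 (min 1 ((t - knot n x i) / (knot n x (i + 1) - knot n x i))) +
        (z (i + 1) - z i) * max 0 (min 1 ((t - knot n x i) / (knot n x (i + 1) - knot n x i))) :=
      fun i _ => by ring
    rw [Finset.sum_congr rfl this, Finset.sum_add_distrib]
    ring
  map_smul' c y := by
    simp only [plValue, Pi.smul_apply, smul_eq_mul, RingHom.id_apply, mul_add, Finset.mul_sum]
    congr 1
    exact Finset.sum_congr rfl fun i _ => by ring

/-- Equal ordinates `1` at all `n + 2` change points give the constant function `1`, so the
coefficients of the linear form sum to `1`. -/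
theorem exists_plValueLinear_single_ne_zero (n : ℕ) (x : ℕ → unitInterval) (t : ℝ) :
    ∃ j, plValueLinear n x t (Pi.single j 1) ≠ 0 := by
  by_contra! h
  have h1 : plValueLinear n x t (∑ j ∈ Finset.range (n + 2), Pi.single j (1 : ℝ)) = 1 := by
    have hone : ∀ i < n + 2, (∑ j ∈ Finset.range (n + 2), Pi.single j (1 : ℝ) : ℕ → ℝ) i = 1 := by
      intro i hi
      rw [Finset.sum_apply, Finset.sum_eq_single i]
      · simp
      · intro j _ hj
        simp [hj.symm]
      · intro hi'
        exact absurd (Finset.mem_range.2 hi) hi'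
    change plValue n x _ t = 1
    unfold plValue
    rw [hone 0 (by omega), Finset.sum_eq_zero, add_zero]
    intro i hi
    have := Finset.mem_range.1 hi
    rw [hone i (by omega), hone (i + 1) (by omega), sub_self, zero_mul]
  rw [map_sum, Finset.sum_eq_zero fun j _ => h j] at h1
  exact zero_ne_one h1

theorem measurable_eval_plFun (t : unitInterval) : Measurable fun p => plFun p t :=
  (continuous_eval_const (F := C01) t).measurable.comp measurable_plFun

theorem ae_plFun_apply_ne (t : unitInterval) (a : ℝ) : ∀ᵐ p ∂paramMeasure, plFun p t ≠ a := by
  have hm : MeasurableSet {p : Param | plFun p t ≠ a} :=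
    (measurable_eval_plFun t (measurableSet_singleton a)).compl
  unfold paramMeasure
  rw [Measure.ae_prod_iff_ae_ae hm]
  refine Filter.Eventually.of_forall fun n => ?_
  have hm' : MeasurableSet {q : (ℕ → unitInterval) × (ℕ → ℝ) | plFun (n, q) t ≠ a} :=
    measurable_prodMk_left hm
  rw [Measure.ae_prod_iff_ae_ae hm']
  refine Filter.Eventually.of_forall fun x => ?_
  obtain ⟨j, hj⟩ := exists_plValueLinear_single_ne_zero n x t
  refine ae_linear_ne (plValueLinear n x t) ?_ hj a
  exact (measurable_eval_plFun t).comp (measurable_prodMk_left.comp measurable_prodMk_left)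

theorem ae_sub_plFun_apply_ne_int (t : unitInterval) (b : ℝ) :
    ∀ᵐ p ∂paramMeasure, ∀ k : ℤ, b - plFun p t ≠ k := by
  rw [ae_all_iff]
  intro k
  filter_upwards [ae_plFun_apply_ne t (b - k)] with p hp hk
  exact hp (by linarith)

/-! ### Almost sure general position of an independent sequence -/

/-- The law of an independent sequence of parameters. -/
noncomputable def paramSeqMeasure : Measure (ℕ → Param) :=
  Measure.infinitePi fun _ => paramMeasure

instance instIsProbabilityMeasureParamSeqMeasure : IsProbabilityMeasure paramSeqMeasure := by
  unfold paramSeqMeasure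
  infer_instance

theorem map_paramSeqMeasure :
    paramSeqMeasure.map (fun p i => plFun (p i)) = Measure.infinitePi fun _ : ℕ => plMeasure :=
  Measure.infinitePi_map_pi (fun _ : ℕ => paramMeasure) fun _ => measurable_plFun

/-- The test point depends on `p i` alone, so it stays fixed while `p j` is resampled. It will be a
rational point or a knot of the `i`-th function. -/
theorem ae_sub_ne_int {τ : Param → unitInterval} (hτ : Measurable τ) {i j : ℕ} (hij : i ≠ j) :
    ∀ᵐ p ∂paramSeqMeasure, ∀ k : ℤ,
      plFun (p i) (τ (p i)) - plFun (p j) (τ (p i)) ≠ k := by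
  have hev : Measurable fun z : C01 × unitInterval => z.1 z.2 := continuous_eval.measurable
  have hm : ∀ l : ℕ, Measurable fun p : ℕ → Param => plFun (p l) (τ (p i)) := fun l =>
    hev.comp ((measurable_plFun.comp (measurable_pi_apply l)).prodMk
      (hτ.comp (measurable_pi_apply i)))
  refine ae_infinitePi_of_ae_update _ j ?_ (Filter.Eventually.of_forall fun p => ?_)
  · rw [ofPred_forall]
    exact MeasurableSet.iInter fun k =>
      (((hm i).sub (hm j)) (measurableSet_singleton (k : ℝ))).compl
  · filter_upwards [ae_sub_plFun_apply_ne_int (τ (p i)) (plFun (p i) (τ (p i)))] with a ha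
    simpa [Function.update_of_ne hij] using ha

theorem mem_cr_iff {f g : C01} {t : unitInterval} : t ∈ cr f g ↔ ∃ k : ℤ, f t - g t = k :=
  Int.fract_eq_fract

/-- Projection along the compact unit interval preserves closedness. This supplies the measurability
needed for resampling in `ae_disjoint_cr`. -/
theorem isClosed_setOf_exists_mem_cr :
    IsClosed {z : (C01 × C01) × (C01 × C01) | ∃ t, t ∈ cr z.1.1 z.1.2 ∧ t ∈ cr z.2.1 z.2.2} := by
  have hZ : IsClosed (range ((↑) : ℤ → ℝ)) := Int.isClosedEmbedding_coe_real.isClosed_range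
  have hS : IsClosed {w : ((C01 × C01) × (C01 × C01)) × unitInterval |
      w.2 ∈ cr w.1.1.1 w.1.1.2 ∧ w.2 ∈ cr w.1.2.1 w.1.2.2} := by
    have h1 : Continuous fun w : ((C01 × C01) × (C01 × C01)) × unitInterval =>
        w.1.1.1 w.2 - w.1.1.2 w.2 := by fun_prop
    have h2 : Continuous fun w : ((C01 × C01) × (C01 × C01)) × unitInterval =>
        w.1.2.1 w.2 - w.1.2.2 w.2 := by fun_prop
    convert (hZ.preimage h1).inter (hZ.preimage h2) using 1
    ext w
    simp only [mem_cr_iff, mem_inter_iff, mem_preimage, mem_range, mem_ofPred_eq, eq_comm]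
  convert isClosedMap_fst_of_compactSpace _ hS using 1
  ext z
  simp

/-- The first crossing set is finite and does not involve `p l`, so a resampled `p l` almost surely
has no crossing with `p k` at its points. The index `k` may coincide with `i` or `j`. -/
theorem ae_disjoint_cr {i j k l : ℕ} (hil : i ≠ l) (hjl : j ≠ l) (hkl : k ≠ l)
    (hfin : ∀ᵐ p ∂paramSeqMeasure, (cr (plFun (p i)) (plFun (p j))).Finite) :
    ∀ᵐ p ∂paramSeqMeasure,
      Disjoint (cr (plFun (p i)) (plFun (p j))) (cr (plFun (p k)) (plFun (p l))) := by
  have hm : ∀ m : ℕ, Measurable fun p : ℕ → Param => plFun (p m) := fun m =>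
    measurable_plFun.comp (measurable_pi_apply m)
  refine ae_infinitePi_of_ae_update _ l ?_ ?_
  · have := (((hm i).prodMk (hm j)).prodMk ((hm k).prodMk (hm l)))
      isClosed_setOf_exists_mem_cr.measurableSet
    convert this.compl using 1
    ext p
    simp [Set.disjoint_left]
  · filter_upwards [hfin] with p hp
    have hae := (ae_ball_iff hp.countable).2 fun t (_ : t ∈ cr (plFun (p i)) (plFun (p j))) =>
      ae_sub_plFun_apply_ne_int t (plFun (p k) t)
    filter_upwards [hae] with a ha
    simp only [Function.update_of_ne hil, Function.update_of_ne hjl, Function.update_of_ne hkl,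
      Function.update_self, Set.disjoint_left]
    intro t ht ht'
    obtain ⟨m, hm⟩ := mem_cr_iff.1 ht'
    exact ha t ht m hm

/-! ### Piecewise affine functions -/

/-- `f` is affine on every interval whose interior avoids `S`. -/
def AffineOff (S : Set ℝ) (f : ℝ → ℝ) : Prop :=
  ∀ u v, u < v → (∀ s ∈ S, s ∉ Ioo u v) → ∃ α β : ℝ, ∀ t ∈ Icc u v, f t = α + β * t

theorem AffineOff.mono {S T : Set ℝ} {f : ℝ → ℝ} (h : AffineOff S f) (hST : S ⊆ T) :
    AffineOff T f := fun u v huv hT => h u v huv fun s hs => hT s (hST hs)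

theorem affineOff_const (S : Set ℝ) (c : ℝ) : AffineOff S fun _ => c :=
  fun _ _ _ _ => ⟨c, 0, fun _ _ => by ring⟩

theorem AffineOff.add {S : Set ℝ} {f g : ℝ → ℝ} (hf : AffineOff S f) (hg : AffineOff S g) :
    AffineOff S fun t => f t + g t := by
  intro u v huv hS
  obtain ⟨a, b, h⟩ := hf u v huv hS
  obtain ⟨a', b', h'⟩ := hg u v huv hS
  exact ⟨a + a', b + b', fun t ht => by simp only [h t ht, h' t ht]; ring⟩

theorem AffineOff.const_mul {S : Set ℝ} {f : ℝ → ℝ} (c : ℝ) (hf : AffineOff S f) :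
    AffineOff S fun t => c * f t := by
  intro u v huv hS
  obtain ⟨a, b, h⟩ := hf u v huv hS
  exact ⟨c * a, c * b, fun t ht => by simp only [h t ht]; ring⟩

theorem AffineOff.sub {S : Set ℝ} {f g : ℝ → ℝ} (hf : AffineOff S f) (hg : AffineOff S g) :
    AffineOff S fun t => f t - g t := by
  simpa [sub_eq_add_neg] using hf.add (hg.const_mul (-1))

theorem AffineOff.sum {S : Set ℝ} {ι : Type*} {F : ι → ℝ → ℝ} (s : Finset ι)
    (h : ∀ i ∈ s, AffineOff S (F i)) : AffineOff S fun t => ∑ i ∈ s, F i t := by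
  classical
  induction s using Finset.induction_on with
  | empty => simpa using affineOff_const S 0
  | insert a s ha ih =>
    simp only [Finset.sum_insert ha]
    exact (h a (Finset.mem_insert_self a s)).add
      (ih fun i hi => h i (Finset.mem_insert_of_mem hi))

theorem affineOff_clamp {S : Set ℝ} {a b : ℝ} (hab : a ≤ b) (ha : a ∈ S) (hb : b ∈ S) :
    AffineOff S fun t => max 0 (min 1 ((t - a) / (b - a))) := by
  intro u v huv hS
  rcases hab.eq_or_lt with rfl | hab
  -- For coinciding knots the quotient is a division by zero, so the clamp vanishes identically.
  · exact ⟨0, 0, fun t _ => by simp⟩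
  have hpos : 0 < b - a := sub_pos.2 hab
  by_cases h1 : v ≤ a
  · refine ⟨0, 0, fun t ht => ?_⟩
    have : (t - a) / (b - a) ≤ 0 :=
      div_nonpos_of_nonpos_of_nonneg (by linarith [ht.2]) hpos.le
    simp only [max_eq_left ((min_le_right _ _).trans this)]
    ring
  by_cases h2 : b ≤ u
  · refine ⟨1, 0, fun t ht => ?_⟩
    have : 1 ≤ (t - a) / (b - a) := by
      rw [one_le_div hpos]
      linarith [ht.1]
    simp only [min_eq_left this, max_eq_right zero_le_one]
    ring
  have h3 : a ≤ u := not_lt.1 fun h => hS a ha ⟨h, not_le.1 h1⟩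
  have h4 : v ≤ b := not_lt.1 fun h => hS b hb ⟨not_le.1 h2, h⟩
  refine ⟨-a / (b - a), 1 / (b - a), fun t ht => ?_⟩
  have h5 : (t - a) / (b - a) ≤ 1 := by
    rw [div_le_one hpos]
    linarith [ht.2]
  have h6 : 0 ≤ (t - a) / (b - a) := div_nonneg (by linarith [ht.1]) hpos.le
  simp only [min_eq_right h5, max_eq_right h6]
  ring

/-- The set of change points. -/
def knots (n : ℕ) (x : ℕ → unitInterval) : Set ℝ := knot n x '' Iic (n + 1)

theorem finite_knots (n : ℕ) (x : ℕ → unitInterval) : (knots n x).Finite :=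
  (finite_Iic _).image _

theorem knot_mem_Icc (n : ℕ) (x : ℕ → unitInterval) (i : ℕ) : knot n x i ∈ Icc (0 : ℝ) 1 := by
  cases i with
  | zero => simp [knot]
  | succ i =>
    simp only [knot]
    split_ifs
    · exact Subtype.property _
    · simp

theorem affineOff_plValue (n : ℕ) (x : ℕ → unitInterval) (y : ℕ → ℝ) :
    AffineOff (knots n x) (plValue n x y) := by
  unfold plValue
  refine (affineOff_const _ _).add (AffineOff.sum _ fun i hi => AffineOff.const_mul _ ?_)
  have := Finset.mem_range.1 hi
  exact affineOff_clamp (knot_le_succ n x i) (mem_image_of_mem _ (mem_Iic.2 (by omega)))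
    (mem_image_of_mem _ (mem_Iic.2 (by omega)))

theorem exists_lipschitzWith_plFun (p : Param) : ∃ K : NNReal, LipschitzWith K (plFun p) := by
  obtain ⟨n, x, y⟩ := p
  have hclamp : LipschitzWith 1 fun s : ℝ => max 0 (min 1 s) := by
    simpa using (LipschitzWith.id.const_min (1 : ℝ)).const_max 0
  have hterm : ∀ i, ∃ K : NNReal, LipschitzWith K fun t : unitInterval => (y (i + 1) - y i) *
      max 0 (min 1 (((t : ℝ) - knot n x i) / (knot n x (i + 1) - knot n x i))) := by
    intro i
    set d := knot n x (i + 1) - knot n x i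
    have h1 : LipschitzWith ‖d⁻¹‖₊ fun t : unitInterval => ((t : ℝ) - knot n x i) / d := by
      refine LipschitzWith.of_dist_le_mul fun s t => ?_
      rw [Real.dist_eq, Subtype.dist_eq, Real.dist_eq, coe_nnnorm, Real.norm_eq_abs, ← abs_mul]
      apply le_of_eq
      congr 1
      ring
    have h2 := hclamp.comp h1
    refine ⟨‖y (i + 1) - y i‖₊ * (1 * ‖d⁻¹‖₊), LipschitzWith.of_dist_le_mul fun s t => ?_⟩
    have h3 := h2.dist_le_mul s t
    rw [Real.dist_eq, ← mul_sub, abs_mul, NNReal.coe_mul, mul_assoc]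
    exact mul_le_mul_of_nonneg_left h3 (abs_nonneg _)
  choose K hK using hterm
  refine ⟨0 + ∑ i ∈ Finset.range (n + 1), K i, ?_⟩
  have hsum : ∀ s : Finset ℕ, LipschitzWith (∑ i ∈ s, K i) fun t : unitInterval =>
      ∑ i ∈ s, (y (i + 1) - y i) *
        max 0 (min 1 (((t : ℝ) - knot n x i) / (knot n x (i + 1) - knot n x i))) := by
    intro s
    induction s using Finset.induction_on with
    | empty => simp
    | insert a s ha ih =>
      simp only [Finset.sum_insert ha]
      exact (hK a).add ih
  exact (LipschitzWith.const (y 0)).add (hsum _)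

/-! ### Crossings of piecewise affine functions in general position -/

/-- The point `t` is neither an endpoint nor a breakpoint, so `d` is affine around it. Zero slope
would give `d` the integer value `k` at a nearby rational point. -/
theorem exists_affine_near {S : Set ℝ} (hSf : S.Finite) {d : ℝ → ℝ} (hd : AffineOff S d)
    (hrat : ∀ q : ℚ, (q : ℝ) ∈ Icc (0 : ℝ) 1 → ∀ k : ℤ, d q ≠ k)
    (hS : ∀ s ∈ S, ∀ k : ℤ, d s ≠ k) {t : ℝ} (ht : t ∈ Icc (0 : ℝ) 1) {k : ℤ} (hk : d t = k) :
    ∃ ε > 0, ∃ β ≠ 0, Icc (t - ε) (t + ε) ⊆ Icc 0 1 ∧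
      ∀ s ∈ Icc (t - ε) (t + ε), d s = k + β * (s - t) := by
  have h0 : t ≠ 0 := by
    rintro rfl
    exact hrat 0 (by simp) k (by simpa using hk)
  have h1 : t ≠ 1 := by
    rintro rfl
    exact hrat 1 (by simp) k (by simpa using hk)
  have htS : t ∉ S := fun h => hS t h k hk
  have hopen : IsOpen (Ioo (0 : ℝ) 1 ∩ Sᶜ) := isOpen_Ioo.inter hSf.isClosed.isOpen_compl
  obtain ⟨ε, hε, hball⟩ := Metric.isOpen_iff.1 hopen t
    ⟨⟨lt_of_le_of_ne ht.1 h0.symm, lt_of_le_of_ne ht.2 h1⟩, htS⟩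
  have hsub : Icc (t - ε / 2) (t + ε / 2) ⊆ Ioo (0 : ℝ) 1 ∩ Sᶜ := fun s hs => hball (by
    rw [Metric.mem_ball, Real.dist_eq, abs_lt]
    constructor <;> linarith [hs.1, hs.2])
  obtain ⟨α, β, hαβ⟩ := hd (t - ε / 2) (t + ε / 2) (by linarith)
    fun s hs hs' => (hsub ⟨hs'.1.le, hs'.2.le⟩).2 hs
  have hform : ∀ s ∈ Icc (t - ε / 2) (t + ε / 2), d s = k + β * (s - t) := by
    intro s hs
    rw [← hk, hαβ s hs, hαβ t ⟨by linarith, by linarith⟩]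
    ring
  refine ⟨ε / 2, by linarith, β, ?_, fun s hs => ⟨(hsub hs).1.1.le, (hsub hs).1.2.le⟩, hform⟩
  rintro rfl
  obtain ⟨q, hq1, hq2⟩ := exists_rat_btwn (show t - ε / 2 < t + ε / 2 by linarith)
  have hq : (q : ℝ) ∈ Icc (t - ε / 2) (t + ε / 2) := ⟨hq1.le, hq2.le⟩
  exact hrat q ⟨(hsub hq).1.1.le, (hsub hq).1.2.le⟩ k (by simpa using hform q hq)

variable {S : Set ℝ} {d : ℝ → ℝ}

/-- Infinitely many solutions would accumulate at another solution. Near it `d` can only take the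
same integer, which its nonzero slope excludes. -/
theorem finite_setOf_eq_int (hSf : S.Finite) (hd : AffineOff S d) (hdc : Continuous d)
    (hrat : ∀ q : ℚ, (q : ℝ) ∈ Icc (0 : ℝ) 1 → ∀ k : ℤ, d q ≠ k)
    (hS : ∀ s ∈ S, ∀ k : ℤ, d s ≠ k) : {t : unitInterval | ∃ k : ℤ, d t = k}.Finite := by
  by_contra hinf
  obtain ⟨t, -, ht⟩ := Set.Infinite.exists_accPt_of_subset_isCompact hinf isCompact_univ
    (subset_univ _)
  have hcl : IsClosed {t : unitInterval | ∃ k : ℤ, d t = k} := by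
    have := (Int.isClosedEmbedding_coe_real.isClosed_range).preimage
      (hdc.comp (continuous_subtype_val (p := (· ∈ unitInterval))))
    convert this using 1
    ext t
    simp [eq_comm]
  obtain ⟨k, hk⟩ : t ∈ {t : unitInterval | ∃ k : ℤ, d t = k} :=
    hcl.closure_subset (mem_closure_iff_clusterPt.2 ht.clusterPt)
  obtain ⟨ε, hε, β, hβ, -, hform⟩ := exists_affine_near hSf hd hrat hS t.2 hk
  rw [accPt_iff_nhds] at ht
  have hnhds : {s : unitInterval | |(s : ℝ) - t| < ε ∧ |d s - d t| < 1} ∈ nhds t := by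
    apply IsOpen.mem_nhds
    · apply IsOpen.inter
      · exact isOpen_lt ((continuous_subtype_val.sub continuous_const).abs) continuous_const
      · exact isOpen_lt (((hdc.comp continuous_subtype_val).sub continuous_const).abs)
          continuous_const
    · simp [hε]
  obtain ⟨s, ⟨⟨hs1, hs2⟩, m, hm⟩, hst⟩ := ht _ hnhds
  have hmk : m = k := by
    rw [hm, hk, ← Int.cast_sub, ← Int.cast_abs, ← Int.cast_one, Int.cast_lt,
      Int.abs_lt_one_iff] at hs2
    omega
  rw [abs_lt] at hs1
  have := hform s ⟨by linarith, by linarith⟩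
  rw [hm, hmk, left_eq_add, mul_eq_zero, sub_eq_zero] at this
  rcases this with h | h
  · exact hβ h
  · exact hst (Subtype.ext h)

theorem not_isLocalExtr_of_affine {φ : unitInterval → ℝ} {t : unitInterval} {ε β c : ℝ}
    (hε : 0 < ε) (hβ : β ≠ 0) (hsub : Icc ((t : ℝ) - ε) (t + ε) ⊆ Icc 0 1)
    (hform : ∀ s : unitInterval, (s : ℝ) ∈ Icc ((t : ℝ) - ε) (t + ε) →
      φ s = c + β * ((s : ℝ) - t)) : ¬ IsLocalExtr φ t := by
  have hstep : ∀ U ∈ nhds t, ∃ e > 0, ∃ s ∈ U, ∃ s' ∈ U, φ s = φ t + β * e ∧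
      φ s' = φ t - β * e := by
    intro U hU
    obtain ⟨δ, hδ, hball⟩ := Metric.mem_nhds_iff.1 hU
    set e := min ε (δ / 2) with he
    have he0 : 0 < e := lt_min hε (by linarith)
    have he1 : e ≤ ε := min_le_left _ _
    have he2 : e ≤ δ / 2 := min_le_right _ _
    have hp : (t : ℝ) + e ∈ Icc ((t : ℝ) - ε) (t + ε) := ⟨by linarith, by linarith⟩
    have hm : (t : ℝ) - e ∈ Icc ((t : ℝ) - ε) (t + ε) := ⟨by linarith, by linarith⟩
    have ht := hform t ⟨by linarith, by linarith⟩
    refine ⟨e, he0, ⟨t + e, hsub hp⟩, hball ?_, ⟨t - e, hsub hm⟩, hball ?_, ?_, ?_⟩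
    · rw [Metric.mem_ball, Subtype.dist_eq, Real.dist_eq]
      simp only [add_sub_cancel_left, abs_of_pos he0]
      linarith
    · rw [Metric.mem_ball, Subtype.dist_eq, Real.dist_eq]
      simp only [sub_sub_cancel_left, abs_neg, abs_of_pos he0]
      linarith
    · rw [hform _ hp, ht]
      ring
    · rw [hform _ hm, ht]
      ring
  rintro (h | h)
  · obtain ⟨e, he, s, hs, s', hs', h1, h2⟩ := hstep _ h
    simp only [mem_ofPred_eq] at hs hs'
    have : β * e = 0 := by linarith
    exact (mul_ne_zero hβ he.ne') this
  · obtain ⟨e, he, s, hs, s', hs', h1, h2⟩ := hstep _ h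
    simp only [mem_ofPred_eq] at hs hs'
    have : β * e = 0 := by linarith
    exact (mul_ne_zero hβ he.ne') this

/-- The parameters `p` and `q` are in general position: the difference of their functions is not an
integer at any rational point nor at any change point. -/
structure GeneralPosition (p q : Param) : Prop where
  rat : ∀ r : ℚ, (r : ℝ) ∈ Icc (0 : ℝ) 1 → ∀ k : ℤ,
    plValue p.1 p.2.1 p.2.2 r - plValue q.1 q.2.1 q.2.2 r ≠ k
  knots_left : ∀ s ∈ knots p.1 p.2.1, ∀ k : ℤ,
    plValue p.1 p.2.1 p.2.2 s - plValue q.1 q.2.1 q.2.2 s ≠ k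
  knots_right : ∀ s ∈ knots q.1 q.2.1, ∀ k : ℤ,
    plValue p.1 p.2.1 p.2.2 s - plValue q.1 q.2.1 q.2.2 s ≠ k

namespace GeneralPosition

variable {p q : Param}

theorem affineOff (p q : Param) : AffineOff (knots p.1 p.2.1 ∪ knots q.1 q.2.1)
    fun t => plValue p.1 p.2.1 p.2.2 t - plValue q.1 q.2.1 q.2.2 t :=
  ((affineOff_plValue _ _ _).mono subset_union_left).sub
    ((affineOff_plValue _ _ _).mono subset_union_right)

theorem finite_cr (h : GeneralPosition p q) : (cr (plFun p) (plFun q)).Finite := by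
  convert finite_setOf_eq_int ((finite_knots _ _).union (finite_knots _ _)) (affineOff p q)
    ((continuous_plValue _ _ _).sub (continuous_plValue _ _ _)) h.rat ?_ using 1
  · ext t
    exact mem_cr_iff
  · rintro s (hs | hs)
    · exact h.knots_left s hs
    · exact h.knots_right s hs

theorem zero_notMem (h : GeneralPosition p q) : (0 : unitInterval) ∉ cr (plFun p) (plFun q) := by
  rw [mem_cr_iff]
  rintro ⟨k, hk⟩
  exact h.rat 0 (by simp) k (by simpa [plFun] using hk)

theorem one_notMem (h : GeneralPosition p q) : (1 : unitInterval) ∉ cr (plFun p) (plFun q) := by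
  rw [mem_cr_iff]
  rintro ⟨k, hk⟩
  exact h.rat 1 (by simp) k (by simpa [plFun] using hk)

theorem not_isLocalExtr (h : GeneralPosition p q) {t : unitInterval}
    (ht : t ∈ cr (plFun p) (plFun q)) :
    ¬ IsLocalExtr (fun s : unitInterval => plFun p s - plFun q s) t := by
  obtain ⟨k, hk⟩ := mem_cr_iff.1 ht
  obtain ⟨ε, hε, β, hβ, hsub, hform⟩ := exists_affine_near
    ((finite_knots _ _).union (finite_knots _ _)) (affineOff p q) h.rat
    (by
      rintro s (hs | hs)
      · exact h.knots_left s hs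
      · exact h.knots_right s hs) t.2 hk
  exact not_isLocalExtr_of_affine hε hβ hsub fun s hs => hform s hs

end GeneralPosition

theorem ae_generalPosition {i j : ℕ} (hij : i ≠ j) :
    ∀ᵐ p ∂paramSeqMeasure, GeneralPosition (p i) (p j) := by
  have hknot : ∀ m : ℕ, Measurable fun p : Param =>
      Set.projIcc (0 : ℝ) 1 zero_le_one (knot p.1 p.2.1 m) := fun m =>
    continuous_projIcc.measurable.comp (measurable_from_prod_countable_right fun n =>
      (measurable_knot n m).comp measurable_fst)
  have hrat : ∀ᵐ p ∂paramSeqMeasure, ∀ r : ℚ, (r : ℝ) ∈ Icc (0 : ℝ) 1 → ∀ k : ℤ,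
      plValue (p i).1 (p i).2.1 (p i).2.2 r - plValue (p j).1 (p j).2.1 (p j).2.2 r ≠ k := by
    rw [ae_all_iff]
    intro r
    by_cases hr : (r : ℝ) ∈ Icc (0 : ℝ) 1
    · filter_upwards [ae_sub_ne_int (measurable_const (a := (⟨r, hr⟩ : unitInterval))) hij]
        with p hp _
      exact hp
    · exact Filter.Eventually.of_forall fun p h => absurd h hr
  filter_upwards [hrat, ae_all_iff.2 fun m => ae_sub_ne_int (hknot m) hij,
    ae_all_iff.2 fun m => ae_sub_ne_int (hknot m) hij.symm] with p h1 h2 h3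
  refine ⟨h1, ?_, ?_⟩
  · rintro _ ⟨m, -, rfl⟩ k hk
    refine h2 m k ?_
    rw [projIcc_of_mem zero_le_one (knot_mem_Icc _ _ m)]
    exact hk
  · rintro _ ⟨m, -, rfl⟩ k hk
    refine h3 m (-k) ?_
    rw [projIcc_of_mem zero_le_one (knot_mem_Icc _ _ m), Int.cast_neg, ← hk, neg_sub]
    rfl

theorem ae_transverse_range : ∀ᵐ p ∂paramSeqMeasure, Transverse (range fun i => plFun (p i)) := by
  have hgp : ∀ᵐ p ∂paramSeqMeasure, ∀ i j, i ≠ j → GeneralPosition (p i) (p j) := by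
    simp only [ae_all_iff]
    exact fun i j hij => ae_generalPosition hij
  have hdisj : ∀ᵐ p ∂paramSeqMeasure, ∀ i j k l : ℕ, i ≠ j → i ≠ l → j ≠ l → k ≠ l →
      Disjoint (cr (plFun (p i)) (plFun (p j))) (cr (plFun (p k)) (plFun (p l))) := by
    simp only [ae_all_iff]
    exact fun i j k l hij hil hjl hkl => ae_disjoint_cr hil hjl hkl <| by
      filter_upwards [ae_generalPosition hij] with p hp using hp.finite_cr
  filter_upwards [hgp, hdisj] with p hp hd
  have hne : ∀ {i j : ℕ}, plFun (p i) ≠ plFun (p j) → i ≠ j := fun h hij => h (by rw [hij])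
  refine ⟨?_, ?_, ?_, ?_, ?_⟩
  · rintro _ ⟨i, rfl⟩ _ ⟨j, rfl⟩ _ ⟨k, rfl⟩ _ ⟨l, rfl⟩ hij hkl hpair
    -- One of `k`, `l` lies outside `{i, j}` because the pairs differ; that index is the one to be
    -- resampled.
    by_cases hl : l = i ∨ l = j
    · have hk : k ≠ i ∧ k ≠ j := by
        constructor
        · rintro rfl
          rcases hl with rfl | rfl
          · exact hkl rfl
          · exact hpair rfl
        · rintro rfl
          rcases hl with rfl | rfl
          · exact hpair Sym2.eq_swap
          · exact hkl rfl
      have hcomm : cr (plFun (p k)) (plFun (p l)) = cr (plFun (p l)) (plFun (p k)) := by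
        ext t
        exact eq_comm
      change Disjoint _ (cr (plFun (p k)) (plFun (p l)))
      rw [hcomm]
      exact hd i j l k (hne hij) hk.1.symm hk.2.symm (hne hkl).symm
    · push Not at hl
      exact hd i j k l (hne hij) hl.1.symm hl.2.symm (hne hkl)
  · rintro _ ⟨i, rfl⟩ _ ⟨j, rfl⟩ h
    exact (hp i j (hne h)).finite_cr
  · rintro _ ⟨i, rfl⟩ _ ⟨j, rfl⟩ h
    exact (hp i j (hne h)).zero_notMem
  · rintro _ ⟨i, rfl⟩ _ ⟨j, rfl⟩ h
    exact (hp i j (hne h)).one_notMem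
  · rintro _ ⟨i, rfl⟩ _ ⟨j, rfl⟩ h t ht
    exact (hp i j (hne h)).not_isLocalExtr ht

/-! ### Piecewise linear functions with almost equidistant knots -/

/-- The equidistant grid with `n` interior points. -/
noncomputable def gridPoint (n i : ℕ) : unitInterval :=
  projIcc (0 : ℝ) 1 zero_le_one (i / (n + 1))

theorem coe_gridPoint {n i : ℕ} (hi : i ≤ n + 1) : (gridPoint n i : ℝ) = i / (n + 1) := by
  have : (i : ℝ) / (n + 1) ∈ Icc (0 : ℝ) 1 := by
    refine ⟨by positivity, ?_⟩
    rw [div_le_one (by positivity)]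
    exact_mod_cast hi
  rw [gridPoint, projIcc_of_mem zero_le_one this]

/-- Parameters with `n` interior knots that are `δ`-close to the equidistant grid, and whose
values are `δ`-close to `b`. -/
def gridBox (n : ℕ) (b : ℕ → ℝ) (δ : ℝ) : Set Param :=
  {p | p.1 = n ∧ (∀ i < n, |(p.2.1 (i + 1) : ℝ) - gridPoint n (i + 1)| < δ) ∧
    ∀ i < n + 2, |p.2.2 i - b i| < δ}

/-- Perturbations by less than half the mesh keep the points in order, so sorting does nothing. -/
theorem knot_succ_eq {n : ℕ} {x : ℕ → unitInterval} {δ : ℝ} (hδ : 2 * δ ≤ 1 / (n + 1))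
    (hx : ∀ i < n, |(x (i + 1) : ℝ) - gridPoint n (i + 1)| < δ) {i : ℕ} (hi : i < n) :
    knot n x (i + 1) = x (i + 1) := by
  have hmono : Monotone fun j : Fin n => x (j + 1) := by
    intro i j hij
    rcases hij.eq_or_lt with rfl | hij
    · exact le_rfl
    have h1 := abs_lt.1 (hx i i.2)
    have h2 := abs_lt.1 (hx j j.2)
    rw [coe_gridPoint (by omega)] at h1 h2
    have h3 : ((i : ℕ) + 1 : ℝ) ≤ (j : ℕ) := by exact_mod_cast hij
    have h4 : (((i : ℕ) + 1 : ℕ) : ℝ) / (n + 1) + 1 / (n + 1) ≤ (((j : ℕ) + 1 : ℕ) : ℝ) / (n + 1) := by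
      rw [← add_div]
      gcongr
      push_cast
      linarith
    change (x (i + 1) : ℝ) ≤ x (j + 1)
    linarith [h1.2, h2.1]
  simp only [knot, dif_pos hi, orderStat, Tuple.sort_eq_refl_iff_monotone.2 hmono]
  rfl

theorem abs_knot_sub_lt {n : ℕ} {x : ℕ → unitInterval} {δ : ℝ} (hδ0 : 0 < δ)
    (hδ : 2 * δ ≤ 1 / (n + 1)) (hx : ∀ i < n, |(x (i + 1) : ℝ) - gridPoint n (i + 1)| < δ)
    {i : ℕ} (hi : i ≤ n + 1) : |knot n x i - i / (n + 1)| < δ := by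
  rcases i with _ | i
  · simpa [knot] using hδ0
  · by_cases h : i < n
    · rw [knot_succ_eq hδ hx h, ← coe_gridPoint hi]
      exact hx i h
    · have : i = n := by omega
      subst this
      have : (i : ℝ) + 1 ≠ 0 := by positivity
      simpa [knot, this] using hδ0

theorem exists_mem_Icc_knot (n : ℕ) (x : ℕ → unitInterval) {t : ℝ} (ht : t ∈ Icc (0 : ℝ) 1) :
    ∃ m ≤ n, t ∈ Icc (knot n x m) (knot n x (m + 1)) := by
  have h0 : knot n x 0 ≤ t := by simpa [knot] using ht.1
  have hex : ∀ k, t ≤ knot n x k → ∃ m ≤ k - 1, t ∈ Icc (knot n x m) (knot n x (m + 1)) := by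
    intro k
    induction k with
    | zero => exact fun h => ⟨0, le_rfl, h0, h.trans (knot_le_succ n x 0)⟩
    | succ k ih =>
      intro h
      rcases le_total t (knot n x k) with h' | h'
      · obtain ⟨m, hm, hmt⟩ := ih h'
        exact ⟨m, by omega, hmt⟩
      · exact ⟨k, by omega, h', h⟩
  obtain ⟨m, hm, hmt⟩ := hex (n + 1) (by simpa [knot] using ht.2)
  exact ⟨m, by omega, hmt⟩

theorem abs_plValue_sub_lt {n : ℕ} {x : ℕ → unitInterval} (y : ℕ → ℝ)
    (hx : ∀ i ≤ n, knot n x i < knot n x (i + 1)) {t c r : ℝ} {m : ℕ} (hm : m ≤ n)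
    (ht : t ∈ Icc (knot n x m) (knot n x (m + 1))) (h1 : |y m - c| < r)
    (h2 : |y (m + 1) - c| < r) : |plValue n x y t - c| < r := by
  rw [plValue_eq_segment n x y hx m hm t ht.1 ht.2]
  have hpos := sub_pos.2 (hx m hm)
  set θ := (t - knot n x m) / (knot n x (m + 1) - knot n x m) with hθ
  have hθ0 : 0 ≤ θ := div_nonneg (by linarith [ht.1]) hpos.le
  have hθ1 : θ ≤ 1 := by
    rw [hθ, div_le_one hpos]
    linarith [ht.2]
  have hconv := convex_ball c r (x := y m) (by simpa [Real.dist_eq] using h1)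
    (y := y (m + 1)) (by simpa [Real.dist_eq] using h2) (sub_nonneg.2 hθ1) hθ0 (by ring)
  rw [Metric.mem_ball, Real.dist_eq, smul_eq_mul, smul_eq_mul] at hconv
  convert hconv using 2
  ring

/-! ### Slopes of chords and approximation by piecewise linear functions -/

/-- The weight of the `i`-th increment in `plValue`. -/
noncomputable def plWeight (n : ℕ) (x : ℕ → unitInterval) (i : ℕ) (t : ℝ) : ℝ :=
  max 0 (min 1 ((t - knot n x i) / (knot n x (i + 1) - knot n x i)))

theorem plWeight_mono (n : ℕ) (x : ℕ → unitInterval) (i : ℕ) : Monotone (plWeight n x i) := by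
  intro s t hst
  have := sub_nonneg.2 (knot_le_succ n x i)
  unfold plWeight
  gcongr

theorem plValue_sub_plValue (n : ℕ) (x : ℕ → unitInterval) (y : ℕ → ℝ) (s t : ℝ) :
    plValue n x y t - plValue n x y s =
      ∑ i ∈ Finset.range (n + 1), (y (i + 1) - y i) * (plWeight n x i t - plWeight n x i s) := by
  simp only [plValue, plWeight, mul_sub, Finset.sum_sub_distrib]
  ring

/-- Ordinates equal to abscissas give the identity. This writes `t - s` with the same weights as an
increment of `plValue`, so slopes can be compared term by term. -/
theorem plValue_knot {n : ℕ} {x : ℕ → unitInterval}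
    (hx : ∀ i ≤ n, knot n x i < knot n x (i + 1)) {t : ℝ} (ht : t ∈ Icc (0 : ℝ) 1) :
    plValue n x (knot n x) t = t := by
  obtain ⟨m, hm, hmt⟩ := exists_mem_Icc_knot n x ht
  rw [plValue_eq_segment n x _ hx m hm t hmt.1 hmt.2, mul_div_cancel₀]
  · ring
  · exact (sub_pos.2 (hx m hm)).ne'

/-- If every segment of the graph that meets `(s, t)` has slope at least `c`, then so does the
chord over `[s, t]`. -/
theorem mul_sub_le_plValue_sub {n : ℕ} {x : ℕ → unitInterval} {y : ℕ → ℝ} {c s t : ℝ}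
    (hx : ∀ i ≤ n, knot n x i < knot n x (i + 1)) (hs : 0 ≤ s) (hst : s ≤ t) (ht : t ≤ 1)
    (hy : ∀ i ≤ n, knot n x i < t → s < knot n x (i + 1) →
      c * (knot n x (i + 1) - knot n x i) ≤ y (i + 1) - y i) :
    c * (t - s) ≤ plValue n x y t - plValue n x y s := by
  conv_lhs => rw [← plValue_knot hx ⟨hs.trans hst, ht⟩, ← plValue_knot hx ⟨hs, hst.trans ht⟩]
  rw [plValue_sub_plValue, plValue_sub_plValue, Finset.mul_sum]
  refine Finset.sum_le_sum fun i hi => ?_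
  have hin : i ≤ n := Nat.lt_succ_iff.1 (Finset.mem_range.1 hi)
  have hpos := sub_pos.2 (hx i hin)
  have hw := sub_nonneg.2 (plWeight_mono n x i hst)
  rw [← mul_assoc]
  by_cases h1 : knot n x i < t
  · by_cases h2 : s < knot n x (i + 1)
    · exact mul_le_mul_of_nonneg_right (hy i hin h1 h2) hw
    · have hone : ∀ r, s ≤ r → plWeight n x i r = 1 := fun r hr => by
        have : 1 ≤ (r - knot n x i) / (knot n x (i + 1) - knot n x i) := by
          rw [one_le_div hpos]
          linarith
        rw [plWeight, min_eq_left this, max_eq_right zero_le_one]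
      simp [hone s le_rfl, hone t hst]
  · have hzero : ∀ r, r ≤ t → plWeight n x i r = 0 := fun r hr => by
      have : (r - knot n x i) / (knot n x (i + 1) - knot n x i) ≤ 0 :=
        div_nonpos_of_nonpos_of_nonneg (by linarith) hpos.le
      rw [plWeight, max_eq_left ((min_le_right _ _).trans this)]
    simp [hzero s hst, hzero t le_rfl]

theorem plValue_const_mul (n : ℕ) (x : ℕ → unitInterval) (c : ℝ) (y : ℕ → ℝ) (t : ℝ) :
    plValue n x (fun i => c * y i) t = c * plValue n x y t :=
  map_smul (plValueLinear n x t) c y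

/-- A continuous function is uniformly approximated by all piecewise linear functions in a
suitable box of parameters. Lower bounds `L + 2` on the slopes of `σ t * f` near finitely many
points `t` are inherited by the approximations, in the weakened form `L + 1`. -/
theorem exists_gridBox_approx (f : C01) {ρ : ℝ} (hρ : 0 < ρ) (C : Set unitInterval)
    (σ : unitInterval → ℝ) (hσ : ∀ t ∈ C, |σ t| = 1) {L η η' : ℝ} (hL : 0 ≤ L) (hη : η' < η)
    (hslope : ∀ t ∈ C, ∀ s s' : unitInterval, s ≤ s' → |(s : ℝ) - t| ≤ η → |(s' : ℝ) - t| ≤ η →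
      (L + 2) * ((s' : ℝ) - s) ≤ σ t * (f s' - f s)) :
    ∃ n : ℕ, ∃ δ > 0, ∀ p ∈ gridBox n (fun i => f (gridPoint n i)) δ,
      (∀ s, |plFun p s - f s| < ρ) ∧
      ∀ t ∈ C, ∀ s s' : unitInterval, s ≤ s' → |(s : ℝ) - t| ≤ η' → |(s' : ℝ) - t| ≤ η' →
        (L + 1) * ((s' : ℝ) - s) ≤ σ t * (plFun p s' - plFun p s) := by
  obtain ⟨ω, hω, hfω⟩ := Metric.uniformContinuous_iff.1
    (CompactSpace.uniformContinuous_of_continuous f.continuous) (ρ / 2) (by linarith)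
  -- The mesh `w` satisfies `2 * w < ω` for uniform closeness, and `η' + 2 * w ≤ η` so that a
  -- segment meeting the smaller window has both its grid points in the larger one.
  obtain ⟨n, hn⟩ := exists_nat_one_div_lt (show 0 < min (ω / 2) ((η - η') / 2) from
    lt_min (by linarith) (by linarith))
  set w : ℝ := 1 / ((n : ℝ) + 1) with hw
  have hw0 : 0 < w := by positivity
  have hwω : 2 * w < ω := by linarith [hn.trans_le (min_le_left _ _)]
  have hwη : η' + 2 * w ≤ η := by linarith [hn.trans_le (min_le_right _ _)]
  -- A perturbed segment has length at most `w + 2 * δ`, and its increment loses at most `2 * δ`.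
  -- The slope bound survives if `(L + 1) * (w + 2 * δ) + 2 * δ ≤ (L + 2) * w`, that is, `(2 * L +
  -- 4) * δ ≤ w`.
  set δ : ℝ := min (ρ / 2) (w / (2 * L + 4)) with hδ
  have hδ0 : 0 < δ := lt_min (by linarith) (by positivity)
  have hδρ : δ ≤ ρ / 2 := min_le_left _ _
  have hδw : (2 * L + 4) * δ ≤ w := by
    have : δ ≤ w / (2 * L + 4) := min_le_right _ _
    rwa [le_div_iff₀ (by linarith), mul_comm] at this
  have hLδ : 0 ≤ L * δ := by positivity
  refine ⟨n, δ, hδ0, ?_⟩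
  rintro ⟨_, x, y⟩ ⟨rfl, hx, hy⟩
  simp only at hx hy hw hn ⊢
  rename_i n
  have hknot : ∀ i ≤ n + 1, |knot n x i - i * w| < δ := fun i hi => by
    have := abs_knot_sub_lt hδ0 (by rw [← hw]; linarith) hx hi
    rwa [div_eq_mul_one_div] at this
  have hgrid : ∀ i ≤ n + 1, (gridPoint n i : ℝ) = i * w := fun i hi => by
    rw [coe_gridPoint hi, div_eq_mul_one_div]
  have hlt : ∀ i ≤ n, knot n x i < knot n x (i + 1) := fun i hi => by
    have h1 := abs_lt.1 (hknot i (by omega))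
    have h2 := abs_lt.1 (hknot (i + 1) (by omega))
    push_cast at h2
    linarith [h1.2, h2.1]
  constructor
  · intro s
    obtain ⟨m, hm, hms⟩ := exists_mem_Icc_knot n x s.2
    have h1 := abs_lt.1 (hknot m (by omega))
    have h2 := abs_lt.1 (hknot (m + 1) (by omega))
    push_cast at h2
    have hclose : ∀ i ≤ n + 1, |(i : ℝ) * w - s| < ω → |y i - f s| < ρ := by
      intro i hi his
      have h3 := hy i (by omega)
      have h4 := @hfω (gridPoint n i) s (by rwa [Subtype.dist_eq, Real.dist_eq, hgrid i hi])
      rw [Real.dist_eq] at h4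
      rw [abs_lt] at *
      constructor <;> linarith [h3.1, h3.2, h4.1, h4.2]
    refine abs_plValue_sub_lt y hlt hm hms (hclose m (by omega) ?_)
      (hclose (m + 1) (by omega) ?_)
    · rw [abs_lt]
      constructor <;> linarith [h1.1, h1.2, h2.1, h2.2, hms.1, hms.2]
    · push_cast
      rw [abs_lt]
      constructor <;> linarith [h1.1, h1.2, h2.1, h2.2, hms.1, hms.2]
  · intro t ht s s' hss hs hs'
    change _ ≤ σ t * (plValue n x y s' - plValue n x y s)
    rw [mul_sub (σ t), ← plValue_const_mul, ← plValue_const_mul]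
    refine mul_sub_le_plValue_sub hlt s.2.1 hss s'.2.2 fun i hi hi1 hi2 => ?_
    have h1 := abs_lt.1 (hknot i (by omega))
    have h2 := abs_lt.1 (hknot (i + 1) (by omega))
    push_cast at h2
    rw [abs_le] at hs hs'
    have hg := hgrid i (by omega)
    have hg' := hgrid (i + 1) (by omega)
    push_cast at hg'
    have h3 := hslope t ht (gridPoint n i) (gridPoint n (i + 1))
      (by
        change (gridPoint n i : ℝ) ≤ gridPoint n (i + 1)
        rw [hg, hg']
        linarith)
      (by
        rw [hg, abs_le]
        constructor <;> linarith [h1.1, h1.2, h2.1, h2.2])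
      (by
        rw [hg', abs_le]
        constructor <;> linarith [h1.1, h1.2, h2.1, h2.2])
    rw [hg, hg'] at h3
    have hσy : ∀ j < n + 2, |σ t * y j - σ t * f (gridPoint n j)| < δ := fun j hj => by
      rw [← mul_sub, abs_mul, hσ t ht, one_mul]
      exact hy j hj
    have h4 := abs_lt.1 (hσy i (by omega))
    have h5 := abs_lt.1 (hσy (i + 1) (by omega))
    have h6 : (L + 1) * (knot n x (i + 1) - knot n x i) ≤ (L + 1) * (w + 2 * δ) :=
      mul_le_mul_of_nonneg_left (by linarith [h1.1, h2.2]) (by linarith)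
    linarith [h4.1, h4.2, h5.1, h5.2]

/-! ### Stability of crossing sets -/

theorem isPreconnected_forall_pos_or_neg {X : Type*} [TopologicalSpace X] {S : Set X}
    (hS : IsPreconnected S) {φ : X → ℝ} (hφ : ContinuousOn φ S) (h0 : ∀ s ∈ S, φ s ≠ 0) :
    (∀ s ∈ S, 0 < φ s) ∨ ∀ s ∈ S, φ s < 0 := by
  by_contra! h
  obtain ⟨⟨a, ha, ha'⟩, b, hb, hb'⟩ := h
  obtain ⟨c, hc, hc'⟩ := hS.intermediate_value ha hb hφ ⟨ha', hb'⟩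
  exact h0 c hc hc'

/-- A continuous function changes sign at an isolated zero that is not a local extremum. -/
theorem exists_sign_change {φ : unitInterval → ℝ} (hφ : Continuous φ) {t : unitInterval}
    (hz : φ t = 0) (hiso : ∀ᶠ s in nhds t, φ s = 0 → s = t) (hext : ¬ IsLocalExtr φ t) :
    ∃ σ : ℝ, |σ| = 1 ∧ ∀ᶠ s in nhds t, s ≠ t → 0 < σ * ((s : ℝ) - t) * φ s := by
  obtain ⟨δ, hδ, hball⟩ := Metric.eventually_nhds_iff.1 hiso
  have hleft := isPreconnected_forall_pos_or_neg (S := {s : unitInterval | s < t ∧ dist s t < δ})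
    (OrdConnected.isPreconnected ⟨fun a ha b hb c hc => ⟨hc.2.trans_lt hb.1, by
      have h1 : (a : ℝ) ≤ c := hc.1
      have h2 : (c : ℝ) ≤ b := hc.2
      have h3 := abs_lt.1 ha.2
      have h4 := abs_lt.1 hb.2
      exact abs_lt.2 ⟨by linarith [h3.1], by linarith [h4.2]⟩⟩⟩) hφ.continuousOn
    fun s hs h => hs.1.ne (hball hs.2 h)
  have hright := isPreconnected_forall_pos_or_neg (S := {s : unitInterval | t < s ∧ dist s t < δ})
    (OrdConnected.isPreconnected ⟨fun a ha b hb c hc => ⟨ha.1.trans_le hc.1, by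
      have h1 : (a : ℝ) ≤ c := hc.1
      have h2 : (c : ℝ) ≤ b := hc.2
      have h3 := abs_lt.1 ha.2
      have h4 := abs_lt.1 hb.2
      exact abs_lt.2 ⟨by linarith [h3.1], by linarith [h4.2]⟩⟩⟩) hφ.continuousOn
    fun s hs h => hs.1.ne' (hball hs.2 h)
  have hnear : ∀ᶠ s in nhds t, dist s t < δ := Metric.ball_mem_nhds t hδ
  -- Equal signs on the two sides would make `t` a local extremum; the two mixed cases determine
  -- `σ`.
  rcases hleft with hl | hl <;> rcases hright with hr | hr
  · refine absurd (Or.inl ?_) hext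
    filter_upwards [hnear] with s hs
    rw [hz]
    rcases lt_trichotomy s t with h | rfl | h
    · exact (hl s ⟨h, hs⟩).le
    · exact hz.ge
    · exact (hr s ⟨h, hs⟩).le
  · refine ⟨-1, by simp, ?_⟩
    filter_upwards [hnear] with s hs hst
    rcases lt_or_gt_of_ne hst with h | h
    · have h' : (s : ℝ) < t := h
      nlinarith [hl s ⟨h, hs⟩]
    · have h' : (t : ℝ) < s := h
      nlinarith [hr s ⟨h, hs⟩]
  · refine ⟨1, by simp, ?_⟩
    filter_upwards [hnear] with s hs hst
    rcases lt_or_gt_of_ne hst with h | h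
    · have h' : (s : ℝ) < t := h
      nlinarith [hl s ⟨h, hs⟩]
    · have h' : (t : ℝ) < s := h
      nlinarith [hr s ⟨h, hs⟩]
  · refine absurd (Or.inr ?_) hext
    filter_upwards [hnear] with s hs
    rw [hz]
    rcases lt_trichotomy s t with h | rfl | h
    · exact (hl s ⟨h, hs⟩).le
    · exact hz.le
    · exact (hr s ⟨h, hs⟩).le

/-- Points of `T` are more than `2 * η` apart, so moving each by at most `η` preserves their order
and matches the two increasing enumerations. -/
theorem closeSets_of_existsUnique {T B : Set unitInterval} (hT : T.Finite) {η ε : ℝ} (hηε : η < ε)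
    (hsep : ∀ t ∈ T, ∀ t' ∈ T, |(t : ℝ) - t'| ≤ 2 * η → t = t')
    (huniq : ∀ t ∈ T, ∃! s : unitInterval, |(s : ℝ) - t| ≤ η ∧ s ∈ B)
    (hout : ∀ s ∈ B, ∃ t ∈ T, |(s : ℝ) - t| ≤ η) : CloseSets ε T B := by
  choose! c hc hcu using huniq
  set a : Fin hT.toFinset.card → unitInterval :=
    ⇑(hT.toFinset.orderEmbOfFin rfl) with ha
  have ha_mem : ∀ i, a i ∈ T := fun i => hT.mem_toFinset.1 (Finset.orderEmbOfFin_mem _ rfl i)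
  have ha_range : range a = T := by
    rw [ha, Finset.range_orderEmbOfFin, hT.coe_toFinset]
  have ha_mono : StrictMono a := OrderEmbedding.strictMono _
  refine ⟨_, a, fun i => c (a i), ha_mono, ?_, ha_range, ?_, fun i => ?_⟩
  · intro i j hij
    have hlt : (a i : ℝ) < a j := ha_mono hij
    have h1 := abs_le.1 (hc _ (ha_mem i)).1
    have h2 := abs_le.1 (hc _ (ha_mem j)).1
    have h3 : 2 * η < (a j : ℝ) - a i := by
      by_contra h
      have := hsep _ (ha_mem j) _ (ha_mem i) (by rw [abs_of_pos (by linarith)]; linarith)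
      exact hlt.ne (by rw [this])
    change (c (a i) : ℝ) < c (a j)
    linarith [h1.2, h2.1]
  · ext s
    constructor
    · rintro ⟨i, rfl⟩
      exact (hc _ (ha_mem i)).2
    · intro hs
      obtain ⟨t, ht, hst⟩ := hout s hs
      obtain ⟨i, rfl⟩ : t ∈ range a := by rwa [ha_range]
      exact ⟨i, (hcu _ ht s ⟨hst, hs⟩).symm⟩
  · rw [abs_sub_comm]
    exact (hc _ (ha_mem i)).1.trans_lt hηε

/-- Existence is the intermediate value theorem and uniqueness is strict monotonicity; the bound `1`
leaves `k` as the only integer difference possible in the window. -/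
theorem existsUnique_mem_cr {g h : C01} {t : unitInterval} {σ η : ℝ} {k : ℤ} (hη : 0 < η)
    (hsub : Icc ((t : ℝ) - η) (t + η) ⊆ Icc 0 1)
    (hmono : ∀ s s' : unitInterval, s < s' → |(s : ℝ) - t| ≤ η → |(s' : ℝ) - t| ≤ η →
      0 < σ * ((g s' - h s') - (g s - h s)))
    (hint : ∀ s : unitInterval, |(s : ℝ) - t| ≤ η → |g s - h s - k| < 1)
    (hleft : ∀ s : unitInterval, (s : ℝ) = t - η → σ * (g s - h s - k) ≤ 0)
    (hright : ∀ s : unitInterval, (s : ℝ) = t + η → 0 ≤ σ * (g s - h s - k)) :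
    ∃! s : unitInterval, |(s : ℝ) - t| ≤ η ∧ s ∈ cr g h := by
  have hval : ∀ s : unitInterval, |(s : ℝ) - t| ≤ η → s ∈ cr g h → g s - h s = k := by
    intro s hs hsc
    obtain ⟨m, hm⟩ := mem_cr_iff.1 hsc
    have h1 := hint s hs
    rw [hm, ← Int.cast_sub, ← Int.cast_abs, ← Int.cast_one, Int.cast_lt,
      Int.abs_lt_one_iff] at h1
    rw [hm, show m = k by omega]
  have hσ : σ ≠ 0 := by
    rintro rfl
    have := hmono ⟨t - η, hsub ⟨le_rfl, by linarith⟩⟩ ⟨t + η, hsub ⟨by linarith, le_rfl⟩⟩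
      (by
        change (t : ℝ) - η < t + η
        linarith) (by simp [abs_of_pos hη]) (by simp [abs_of_pos hη])
    simp at this
  have hcont : Continuous fun s : unitInterval => σ * (g s - h s - k) := by fun_prop
  obtain ⟨s, hs, hs0⟩ := (isPreconnected_Icc (a := (⟨t - η, hsub ⟨le_rfl, by linarith⟩⟩ :
    unitInterval)) (b := ⟨t + η, hsub ⟨by linarith, le_rfl⟩⟩)).intermediate_value
    (left_mem_Icc.2 (by
      change (t : ℝ) - η ≤ t + η
      linarith)) (right_mem_Icc.2 (by
      change (t : ℝ) - η ≤ t + η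
      linarith)) hcont.continuousOn ⟨hleft _ rfl, hright _ rfl⟩
  have hsη : |(s : ℝ) - t| ≤ η := by
    have h1 : (t : ℝ) - η ≤ s := hs.1
    have h2 : (s : ℝ) ≤ t + η := hs.2
    rw [abs_le]
    constructor <;> linarith
  have hsk : g s - h s = k := by
    have := (mul_eq_zero.1 hs0).resolve_left hσ
    linarith
  refine ⟨s, ⟨hsη, mem_cr_iff.2 ⟨k, hsk⟩⟩, ?_⟩
  rintro s' ⟨hs'η, hs'c⟩
  have hs'k := hval s' hs'η hs'c
  rcases lt_trichotomy s' s with hlt | heq | hlt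
  · have := hmono s' s hlt hs'η hsη
    simp [hsk, hs'k] at this
  · exact heq
  · have := hmono s s' hlt hsη hs'η
    simp [hsk, hs'k] at this

/-! ### Distance to the integers, cut-offs and gluing -/

/-- The distance to the nearest integer. -/
noncomputable def intDist (x : ℝ) : ℝ := Metric.infDist x (range ((↑) : ℤ → ℝ))

theorem continuous_intDist : Continuous intDist := Metric.continuous_infDist_pt _

theorem intDist_le (x : ℝ) (k : ℤ) : intDist x ≤ |x - k| :=
  Metric.infDist_le_dist_of_mem (mem_range_self k)

theorem intDist_pos {x : ℝ} (h : ∀ k : ℤ, x ≠ k) : 0 < intDist x :=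
  (Int.isClosedEmbedding_coe_real.isClosed_range.notMem_iff_infDist_pos (range_nonempty _)).1
    (by
      rintro ⟨k, hk⟩
      exact h k hk.symm)

theorem exists_pos_forall_near {C : Set unitInterval} (hC : C.Finite)
    {Q : unitInterval → unitInterval → Prop} (hQ : ∀ t ∈ C, ∀ᶠ s in nhds t, Q t s) {ε : ℝ}
    (hε : 0 < ε) : ∃ r > 0, r < ε ∧ ∀ t ∈ C, ∀ s : unitInterval, |(s : ℝ) - t| ≤ r → Q t s := by
  have h : ∀ᶠ r in nhdsWithin (0 : ℝ) (Ioi 0),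
      ∀ t ∈ C, ∀ s : unitInterval, |(s : ℝ) - t| ≤ r → Q t s := by
    rw [Filter.eventually_all_finite hC]
    intro t ht
    obtain ⟨δ, hδ, hball⟩ := Metric.eventually_nhds_iff.1 (hQ t ht)
    filter_upwards [Ioo_mem_nhdsGT hδ] with r hr s hs
    exact hball (hs.trans_lt hr.2)
  obtain ⟨r, hr, hr'⟩ := (h.and (Ioo_mem_nhdsGT hε)).exists
  exact ⟨r, hr'.1, hr'.2, hr⟩

/-- The trapezoidal cut-off function equal to `1` up to distance `η` from `t` and to `0` from
distance `2 * η` on. -/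
noncomputable def cutoff (η : ℝ) (t s : unitInterval) : ℝ :=
  max 0 (min 1 ((2 * η - |(s : ℝ) - t|) / η))

theorem continuous_cutoff (η : ℝ) (t : unitInterval) : Continuous (cutoff η t) := by
  have h : Continuous fun s : unitInterval => |(s : ℝ) - t| :=
    (continuous_subtype_val.sub continuous_const).abs
  unfold cutoff
  fun_prop

theorem cutoff_nonneg (η : ℝ) (t s : unitInterval) : 0 ≤ cutoff η t s := le_max_left _ _

theorem cutoff_le_one (η : ℝ) (t s : unitInterval) : cutoff η t s ≤ 1 :=
  max_le zero_le_one (min_le_left _ _)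

theorem cutoff_eq_one {η : ℝ} (hη : 0 < η) {t s : unitInterval} (h : |(s : ℝ) - t| ≤ η) :
    cutoff η t s = 1 := by
  have : 1 ≤ (2 * η - |(s : ℝ) - t|) / η := by
    rw [one_le_div hη]
    linarith
  rw [cutoff, min_eq_left this, max_eq_right zero_le_one]

theorem cutoff_eq_zero {η : ℝ} (hη : 0 < η) {t s : unitInterval} (h : 2 * η ≤ |(s : ℝ) - t|) :
    cutoff η t s = 0 := by
  have : (2 * η - |(s : ℝ) - t|) / η ≤ 0 := div_nonpos_of_nonpos_of_nonneg (by linarith) hη.le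
  rw [cutoff, max_eq_left ((min_le_right _ _).trans this)]

/-- Interpolation between `f` and prescribed functions `G t` near the points `t` of a finite set. -/
theorem exists_glue (f : C01) {C : Set unitInterval} (hC : C.Finite) (G : unitInterval → C01)
    {η : ℝ} (hη : 0 < η) (hsep : ∀ t ∈ C, ∀ t' ∈ C, |(t : ℝ) - t'| ≤ 4 * η → t = t') :
    ∃ f₁ : C01, (∀ s : unitInterval, (∀ t ∈ C, 2 * η ≤ |(s : ℝ) - t|) → f₁ s = f s) ∧
      (∀ t ∈ C, ∀ s : unitInterval, |(s : ℝ) - t| ≤ η → f₁ s = G t s) ∧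
      ∀ t ∈ C, ∀ s : unitInterval, |(s : ℝ) - t| < 2 * η → ∃ θ ∈ Icc (0 : ℝ) 1,
        f₁ s = f s + θ * (G t s - f s) := by
  have hcont : Continuous fun s : unitInterval =>
      f s + ∑ t ∈ hC.toFinset, cutoff η t s * (G t s - f s) :=
    f.continuous.add (continuous_finsetSum _ fun t _ =>
      (continuous_cutoff η t).mul ((G t).continuous.sub f.continuous))
  have hform : ∀ t ∈ C, ∀ s : unitInterval, |(s : ℝ) - t| < 2 * η →
      f s + ∑ t ∈ hC.toFinset, cutoff η t s * (G t s - f s) =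
        f s + cutoff η t s * (G t s - f s) := by
    intro t ht s hs
    rw [Finset.sum_eq_single t]
    · intro t' ht' hne
      rw [cutoff_eq_zero hη, zero_mul]
      by_contra h
      refine hne (hsep t' (hC.mem_toFinset.1 ht') t ht ?_)
      have h1 := abs_lt.1 (not_le.1 h)
      have h2 := abs_lt.1 hs
      rw [abs_le]
      constructor <;> linarith [h1.1, h1.2, h2.1, h2.2]
    · exact fun h => absurd (hC.mem_toFinset.2 ht) h
  refine ⟨⟨_, hcont⟩, fun s hs => ?_, fun t ht s hs => ?_, fun t ht s hs => ?_⟩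
  · change f s + ∑ t ∈ hC.toFinset, cutoff η t s * (G t s - f s) = f s
    rw [Finset.sum_eq_zero, add_zero]
    intro t ht
    rw [cutoff_eq_zero hη (hs t (hC.mem_toFinset.1 ht)), zero_mul]
  · change f s + ∑ t ∈ hC.toFinset, cutoff η t s * (G t s - f s) = G t s
    rw [hform t ht s (by linarith), cutoff_eq_one hη hs]
    ring
  · exact ⟨cutoff η t s, ⟨cutoff_nonneg η t s, cutoff_le_one η t s⟩, hform t ht s hs⟩

/-! ### Making the crossings steep -/

/-- The crossing data of `f` at a point `t`: the function `h` of the family that is crossed, the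
integer `k` by which the values differ, and the direction `σ` of the crossing. -/
structure CrossingAt (f : C01) (F : Set C01) (t : unitInterval) (h : C01) (k : ℤ) (σ : ℝ) :
    Prop where
  mem : h ∈ F
  sub_eq : f t - h t = k
  unique : ∀ h' ∈ F, t ∈ cr f h' → h' = h
  abs_sign : |σ| = 1
  sign : ∀ᶠ s in nhds t, s ≠ t → 0 < σ * ((s : ℝ) - t) * (f s - h s - k)

/-- Finiteness of the crossing set isolates the zero of `f - h - k`, and transversality excludes a
local extremum, so the difference changes sign. Disjointness of crossing sets makes `h` unique. -/
theorem exists_crossingAt {F : Set C01} {f : C01} (hfF : f ∉ F) (hT : Transverse (insert f F))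
    {t : unitInterval} (ht : ∃ h ∈ F, t ∈ cr f h) : ∃ h k σ, CrossingAt f F t h k σ := by
  obtain ⟨h, hF, htc⟩ := ht
  obtain ⟨k, hk⟩ := mem_cr_iff.1 htc
  have hne : ∀ {h'}, h' ∈ F → f ≠ h' := fun hh' e => hfF (e ▸ hh')
  have hfin := hT.finite_cr f (mem_insert _ _) h (mem_insert_of_mem _ hF) (hne hF)
  have hext := hT.not_isLocalExtr f (mem_insert _ _) h (mem_insert_of_mem _ hF) (hne hF) t htc
  obtain ⟨σ, hσ, hsign⟩ := exists_sign_change (φ := fun s => f s - h s - k) (by fun_prop)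
    (t := t) (by rw [hk, sub_self])
    (by
      have hopen := (hfin.subset (sdiff_subset (t := {t}))).isClosed.isOpen_compl.mem_nhds
        (x := t) (by simp)
      filter_upwards [hopen] with s hs hs0
      by_contra hst
      exact hs ⟨mem_cr_iff.2 ⟨k, by linarith⟩, hst⟩)
    (by
      rintro (H | H)
      · exact hext (Or.inl (H.mono fun s hs => by linarith))
      · exact hext (Or.inr (H.mono fun s hs => by linarith)))
  refine ⟨h, k, σ, hF, hk, fun h' hF' htc' => ?_, hσ, hsign⟩
  by_contra hhh
  refine Set.disjoint_left.1 (hT.disjoint_cr f (mem_insert _ _) h' (mem_insert_of_mem _ hF')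
    f (mem_insert _ _) h (mem_insert_of_mem _ hF) (hne hF') (hne hF) ?_) htc' htc
  rw [Ne, Sym2.congr_right]
  exact hhh

/-- The points at which `f` crosses some member of `F`. -/
def crossings (f : C01) (F : Set C01) : Set unitInterval := {t | ∃ h ∈ F, t ∈ cr f h}

/-- `f₁` is a small modification of `f` with the same crossings, which crosses the members of `F`
steeply: near `t` its difference to the crossed function `H t` is affine with slope
`±(2 * L + 2)`. -/
structure SteepModification (f f₁ : C01) (F : Set C01) (H : unitInterval → C01)
    (K : unitInterval → ℤ) (σ : unitInterval → ℝ) (L η ε : ℝ) : Prop where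
  crossing : ∀ t ∈ crossings f F, CrossingAt f F t (H t) (K t) (σ t)
  pos : 0 < η
  lt : η < ε
  small : (2 * L + 2) * η < 1 / 2
  sep : ∀ t ∈ crossings f F, ∀ t' ∈ crossings f F, |(t : ℝ) - t'| ≤ 4 * η → t = t'
  sub : ∀ t ∈ crossings f F, Icc ((t : ℝ) - η) (t + η) ⊆ Icc 0 1
  near : ∀ s, |f₁ s - f s| < ε / 2
  eq : ∀ t ∈ crossings f F, ∀ s : unitInterval, |(s : ℝ) - t| ≤ η →
    f₁ s = H t s + K t + σ t * ((2 * L + 2) * ((s : ℝ) - t))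
  mem_cr : ∀ h ∈ F, ∀ s, s ∈ cr f₁ h → s ∈ cr f h

theorem finite_crossings {F : Set C01} (hF : F.Finite) {f : C01} (hfF : f ∉ F)
    (hT : Transverse (insert f F)) : (crossings f F).Finite := by
  have : crossings f F = ⋃ h ∈ F, cr f h := by
    ext t
    simp [crossings]
  rw [this]
  exact hF.biUnion fun h hh => hT.finite_cr f (mem_insert _ _) h (mem_insert_of_mem _ hh)
    fun e => hfF (e ▸ hh)

theorem abs_add_mul_sub_sub_le {a b θ : ℝ} (hθ : θ ∈ Icc (0 : ℝ) 1) :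
    |a + θ * (b - a) - a| ≤ |b - a| := by
  rw [add_sub_cancel_left, abs_mul, abs_of_nonneg hθ.1]
  exact mul_le_of_le_one_left (abs_nonneg _) hθ.2

/-- Near each crossing `f` is interpolated with the steep function `G t`. Both cross `H t` in the
same direction at `t`, so convex combinations of them have no other crossing with it nearby. Other
members of `F` are avoided because `G t` is closer to `f` than `f` is to their integer translates.
-/
theorem exists_steepModification {F : Set C01} (hF : F.Finite) {f : C01} (hfF : f ∉ F)
    (hT : Transverse (insert f F)) {L ε : ℝ} (hL : 0 ≤ L) (hε : 0 < ε) :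
    ∃ f₁ H K σ η, SteepModification f f₁ F H K σ L η ε := by
  have hC := finite_crossings hF hfF hT
  have hcross : ∀ t, t ∈ crossings f F → ∃ h k σ, CrossingAt f F t h k σ :=
    fun t ht => exists_crossingAt hfF hT ht
  choose! H K σ hcr using hcross
  have hG : ∀ t, ∃ G : C01, ∀ s : unitInterval,
      G s = H t s + K t + σ t * ((2 * L + 2) * ((s : ℝ) - t)) := fun t =>
    ⟨⟨fun s => H t s + K t + σ t * ((2 * L + 2) * ((s : ℝ) - t)), by fun_prop⟩, fun s => rfl⟩
  choose G hG using hG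
  have hGt : ∀ t ∈ crossings f F, G t t = f t := fun t ht => by
    rw [hG, ← (hcr t ht).sub_eq]
    ring
  have hne : ∀ {h'}, h' ∈ F → f ≠ h' := fun hh' e => hfF (e ▸ hh')
  -- everything that has to hold near each crossing point
  obtain ⟨r, hr0, hrε, hr⟩ := exists_pos_forall_near hC (Q := fun t s =>
      (s ∈ crossings f F → s = t) ∧ (s ≠ 0 ∧ s ≠ 1) ∧
      (s ≠ t → 0 < σ t * ((s : ℝ) - t) * (f s - H t s - K t)) ∧
      |G t s - f s| < min (ε / 2) (1 / 4) ∧ |f s - H t s - K t| < 1 / 4 ∧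
      ∀ h ∈ F, h ≠ H t → |G t s - f s| < intDist (f s - h s)) (ε := min ε (1 / (2 * L + 2)))
    (by
      intro t ht
      have hGf : Continuous fun s => |G t s - f s| := by fun_prop
      have hGf0 : |G t t - f t| = 0 := by rw [hGt t ht, sub_self, abs_zero]
      have ht0 : t ≠ 0 := by
        rintro rfl
        obtain ⟨h, hh, htc⟩ := ht
        exact hT.zero_notMem f (mem_insert _ _) h (mem_insert_of_mem _ hh) (hne hh) htc
      have ht1 : t ≠ 1 := by
        rintro rfl
        obtain ⟨h, hh, htc⟩ := ht
        exact hT.one_notMem f (mem_insert _ _) h (mem_insert_of_mem _ hh) (hne hh) htc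
      refine Filter.Eventually.and ?_ (Filter.Eventually.and ?_ (Filter.Eventually.and
        (hcr t ht).sign (Filter.Eventually.and ?_ (Filter.Eventually.and ?_ ?_))))
      · filter_upwards [(hC.subset (sdiff_subset (t := {t}))).isClosed.isOpen_compl.mem_nhds
          (x := t) (by simp)] with s hs hsC
        by_contra hst
        exact hs ⟨hsC, hst⟩
      · exact (eventually_ne_nhds ht0).and (eventually_ne_nhds ht1)
      · refine hGf.continuousAt.eventually_lt continuousAt_const ?_
        rw [hGf0]
        exact lt_min (by linarith) (by norm_num)
      · have hc : Continuous fun s => |f s - H t s - K t| := by fun_prop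
        refine hc.continuousAt.eventually_lt continuousAt_const ?_
        rw [(hcr t ht).sub_eq, sub_self, abs_zero]
        norm_num
      · rw [Filter.eventually_all_finite hF]
        intro h hh
        by_cases hH : h = H t
        · exact Filter.Eventually.of_forall fun s hs => absurd hH hs
        · have hc : Continuous fun s => intDist (f s - h s) :=
            continuous_intDist.comp (by fun_prop)
          have := hGf.continuousAt.eventually_lt (hc.continuousAt (x := t)) (by
            rw [hGf0]
            refine intDist_pos fun k hk => hH ?_
            exact (hcr t ht).unique h hh (mem_cr_iff.2 ⟨k, hk⟩))
          exact this.mono fun s hs _ => hs)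
    (lt_min hε (by positivity))
  -- With `η = r / 4`, cut-offs of radius `2 * η` stay inside the good radius `r`, and the
  -- separation `4 * η` required for gluing is `r` itself.
  have hη : 0 < r / 4 := by linarith
  have hsep : ∀ t ∈ crossings f F, ∀ t' ∈ crossings f F, |(t : ℝ) - t'| ≤ 4 * (r / 4) → t = t' :=
    fun t ht t' ht' h => (hr t' ht' t (by linarith)).1 ht
  obtain ⟨f₁, hfar, heq, hbetween⟩ := exists_glue f hC G hη hsep
  have hcases : ∀ s : unitInterval, f₁ s = f s ∨ ∃ t ∈ crossings f F, |(s : ℝ) - t| ≤ r ∧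
      ∃ θ ∈ Icc (0 : ℝ) 1, f₁ s = f s + θ * (G t s - f s) := by
    intro s
    by_cases hs : ∀ t ∈ crossings f F, 2 * (r / 4) ≤ |(s : ℝ) - t|
    · exact Or.inl (hfar s hs)
    · push Not at hs
      obtain ⟨t, ht, hst⟩ := hs
      exact Or.inr ⟨t, ht, by linarith, hbetween t ht s hst⟩
  refine ⟨f₁, H, K, σ, r / 4, ⟨hcr, hη, ?_, ?_, hsep, ?_, ?_, ?_, ?_⟩⟩
  · linarith [hrε.trans_le (min_le_left _ _)]
  · have := hrε.trans_le (min_le_right _ _)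
    rw [lt_div_iff₀ (by linarith)] at this
    linarith
  · intro t ht
    refine Icc_subset_Icc ?_ ?_
    · by_contra h
      exact (hr t ht 0 (by
        rw [Icc.coe_zero, zero_sub, abs_neg, abs_of_nonneg t.2.1]
        linarith)).2.1.1 rfl
    · by_contra h
      exact (hr t ht 1 (by
        rw [Icc.coe_one, abs_of_nonneg (sub_nonneg.2 t.2.2)]
        linarith)).2.1.2 rfl
  · intro s
    rcases hcases s with h | ⟨t, ht, hst, θ, hθ, h⟩
    · rw [h, sub_self, abs_zero]
      linarith
    · rw [h]
      exact (abs_add_mul_sub_sub_le hθ).trans_lt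
        ((hr t ht s hst).2.2.2.1.trans_le (min_le_left _ _))
  · intro t ht s hs
    rw [heq t ht s hs, hG]
  · intro h hh s hs
    obtain ⟨k, hk⟩ := mem_cr_iff.1 hs
    rcases hcases s with hfs | ⟨t, ht, hst, θ, hθ, hfs⟩
    · exact mem_cr_iff.2 ⟨k, by rw [← hfs, hk]⟩
    obtain ⟨-, -, hsign, hGf, hfH, hother⟩ := hr t ht s hst
    have hle := abs_add_mul_sub_sub_le (a := f s) (b := G t s) hθ
    rw [← hfs] at hle
    by_cases hH : h = H t
    · have hkK : k = K t := by
        have h1 : |(k : ℝ) - K t| < 1 := by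
          have h2 := abs_lt.1 (hle.trans_lt (hGf.trans_le (min_le_right _ _)))
          have h3 := abs_lt.1 hfH
          rw [hH] at hk
          rw [abs_lt]
          constructor <;> linarith [h2.1, h2.2, h3.1, h3.2]
        rw [← Int.cast_sub, ← Int.cast_abs, ← Int.cast_one, Int.cast_lt,
          Int.abs_lt_one_iff] at h1
        omega
      have hst' : s = t := by
        by_contra hne'
        have hpos := hsign hne'
        have hne'' : (s : ℝ) - t ≠ 0 := fun e => hne' (Subtype.ext (by linarith))
        have hσ2 : σ t * σ t = 1 := by
          rw [← abs_mul_abs_self, (hcr t ht).abs_sign, one_mul]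
        -- A crossing at `s ≠ t` would make this convex combination of two positive numbers vanish.
        have hzero : (1 - θ) * (σ t * ((s : ℝ) - t) * (f s - H t s - K t)) +
            θ * ((2 * L + 2) * ((s : ℝ) - t) ^ 2) = 0 := by
          have h1 : f s + θ * (G t s - f s) - H t s - K t = 0 := by
            rw [← hfs, ← hkK, ← hk, hH]
            ring
          rw [hG] at h1
          linear_combination (σ t * ((s : ℝ) - t)) * h1 -
            θ * (2 * L + 2) * ((s : ℝ) - t) ^ 2 * hσ2
        have h2 : 0 < (2 * L + 2) * ((s : ℝ) - t) ^ 2 := by positivity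
        rcases hθ.1.eq_or_lt with h0 | h0
        · rw [← h0] at hzero
          linarith
        · have h3 := mul_pos h0 h2
          have h4 := mul_nonneg (sub_nonneg.2 hθ.2) hpos.le
          linarith
      rw [hst', hH]
      exact mem_cr_iff.2 ⟨K t, (hcr t ht).sub_eq⟩
    · have h1 := hother h hh hH
      have h2 := intDist_le (f s - h s) k
      have h3 : |f s - h s - k| = |f₁ s - f s| := by
        rw [← hk, abs_sub_comm]
        congr 1
        ring
      linarith

/-! ### Functions close to a steep modification -/

namespace SteepModification

variable {f f₁ : C01} {F : Set C01} {H : unitInterval → C01} {K : unitInterval → ℤ}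
  {σ : unitInterval → ℝ} {L η ε : ℝ}

/-- The relative slope is `2 * L + 2` and the crossed function `H t` can reduce it by at most `L`.
-/
theorem slope_le (hS : SteepModification f f₁ F H K σ L η ε)
    (hLip : ∀ h ∈ F, ∀ s s' : unitInterval, s ≤ s' → |h s' - h s| ≤ L * ((s' : ℝ) - s))
    {t : unitInterval} (ht : t ∈ crossings f F) {s s' : unitInterval} (hss : s ≤ s')
    (hs : |(s : ℝ) - t| ≤ η) (hs' : |(s' : ℝ) - t| ≤ η) :
    (L + 2) * ((s' : ℝ) - s) ≤ σ t * (f₁ s' - f₁ s) := by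
  have hσ2 : σ t * σ t = 1 := by
    rw [← abs_mul_abs_self, (hS.crossing t ht).abs_sign, one_mul]
  have h1 : |σ t * (H t s' - H t s)| ≤ L * ((s' : ℝ) - s) := by
    rw [abs_mul, (hS.crossing t ht).abs_sign, one_mul]
    exact hLip _ (hS.crossing t ht).mem s s' hss
  have h2 : σ t * (f₁ s' - f₁ s) =
      σ t * (H t s' - H t s) + (2 * L + 2) * ((s' : ℝ) - s) := by
    rw [hS.eq t ht s hs, hS.eq t ht s' hs']
    linear_combination (2 * L + 2) * ((s' : ℝ) - s) * hσ2
  linarith [(abs_le.1 h1).1]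

/-- Away from the crossing points, `f₁` stays at a positive distance from all integer translates
of the members of `F`. -/
theorem exists_le_intDist (hS : SteepModification f f₁ F H K σ L η ε) (hF : F.Finite) {η' : ℝ}
    (hη' : 0 < η') {B : ℝ} (hB : 0 < B) :
    ∃ ρ > 0, ρ < B ∧ ∀ h ∈ F, ∀ s : unitInterval, (∀ t ∈ cr f h, η' ≤ |(s : ℝ) - t|) →
      ρ ≤ intDist (f₁ s - h s) := by
  have hev : ∀ᶠ ρ in nhdsWithin (0 : ℝ) (Ioi 0), ∀ h ∈ F, ∀ s : unitInterval,
      (∀ t ∈ cr f h, η' ≤ |(s : ℝ) - t|) → ρ ≤ intDist (f₁ s - h s) := by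
    rw [Filter.eventually_all_finite hF]
    intro h hh
    have hcl : IsClosed {s : unitInterval | ∀ t ∈ cr f h, η' ≤ |(s : ℝ) - t|} := by
      simp only [ofPred_forall]
      exact isClosed_iInter fun t => isClosed_iInter fun _ =>
        isClosed_le continuous_const (continuous_subtype_val.sub continuous_const).abs
    have hcont : Continuous fun s : unitInterval => intDist (f₁ s - h s) :=
      continuous_intDist.comp (by fun_prop)
    rcases {s : unitInterval | ∀ t ∈ cr f h, η' ≤ |(s : ℝ) - t|}.eq_empty_or_nonempty with he | he
    · exact Filter.Eventually.of_forall fun ρ s hs => absurd (he ▸ hs : s ∈ (∅ : Set _)) (by simp)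
    · obtain ⟨s₀, hs₀, hmin⟩ := hcl.isCompact.exists_isMinOn he hcont.continuousOn
      -- A zero distance would be a crossing of `f₁` with `h`, hence one of `f`, but these are
      -- excluded from the compact set.
      have hpos : 0 < intDist (f₁ s₀ - h s₀) := intDist_pos fun k hk => by
        have := hs₀ s₀ (hS.mem_cr h hh s₀ (mem_cr_iff.2 ⟨k, hk⟩))
        rw [sub_self, abs_zero] at this
        linarith
      filter_upwards [Ioo_mem_nhdsGT hpos] with ρ hρ s hs
      exact hρ.2.le.trans (hmin hs)
  obtain ⟨ρ, hρ, hρ'⟩ := (hev.and (Ioo_mem_nhdsGT hB)).exists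
  exact ⟨ρ, hρ'.1, hρ'.2, hρ⟩

theorem exists_isSmoothApprox (hS : SteepModification f f₁ F H K σ L η ε) (hF : F.Finite)
    (hfin : ∀ h ∈ F, (cr f h).Finite) (hL : 0 ≤ L) (hε : 0 < ε)
    (hLip : ∀ h ∈ F, ∀ s s' : unitInterval, s ≤ s' → |h s' - h s| ≤ L * ((s' : ℝ) - s)) :
    ∃ ρ > 0, ∀ g : C01, (∀ s, |g s - f₁ s| < ρ) →
      (∀ t ∈ crossings f F, ∀ s s' : unitInterval, s ≤ s' → |(s : ℝ) - t| ≤ η / 2 →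
        |(s' : ℝ) - t| ≤ η / 2 → (L + 1) * ((s' : ℝ) - s) ≤ σ t * (g s' - g s)) →
      IsSmoothApprox ε F f g := by
  have hη := hS.pos
  -- The three bounds on `ρ` serve, in order, the norm estimate, the uniqueness of the integer in
  -- each window, and the signs of `g - h - K t` at the ends of the window.
  obtain ⟨ρ, hρ0, hρB, hρ⟩ := hS.exists_le_intDist hF (half_pos hη)
    (B := min (ε / 2) (min (1 / 2) ((2 * L + 2) * (η / 2))))
    (lt_min (by linarith) (lt_min (by norm_num) (by positivity)))
  have hρ1 := hρB.trans_le (min_le_left _ _)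
  have hρ2 := (hρB.trans_le (min_le_right _ _)).trans_le (min_le_left _ _)
  have hρ3 := (hρB.trans_le (min_le_right _ _)).trans_le (min_le_right _ _)
  refine ⟨ρ, hρ0, fun g hg hslope => ⟨?_, fun h hh => ?_⟩⟩
  · rw [ContinuousMap.norm_lt_iff _ hε]
    intro s
    have h1 := abs_lt.1 (hS.near s)
    have h2 := abs_lt.1 (hg s)
    rw [ContinuousMap.sub_apply, Real.norm_eq_abs, abs_lt]
    constructor <;> linarith [h1.1, h1.2, h2.1, h2.2]
  have hcross : ∀ t ∈ cr f h, t ∈ crossings f F := fun t ht => ⟨h, hh, ht⟩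
  refine closeSets_of_existsUnique (hfin h hh) (η := η / 2) (by linarith [hS.lt])
    (fun t ht t' ht' htt => hS.sep t (hcross t ht) t' (hcross t' ht') (by linarith))
    (fun t ht => ?_) (fun s hs => ?_)
  · have htC := hcross t ht
    have hcr := hS.crossing t htC
    have hhH : h = H t := hcr.unique h hh ht
    have hσ2 : σ t * σ t = 1 := by rw [← abs_mul_abs_self, hcr.abs_sign, one_mul]
    have hσg : ∀ s, |σ t * (g s - f₁ s)| < ρ := fun s => by
      rw [abs_mul, hcr.abs_sign, one_mul]
      exact hg s
    have hval : ∀ s : unitInterval, |(s : ℝ) - t| ≤ η / 2 →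
        f₁ s - h s - K t = σ t * ((2 * L + 2) * ((s : ℝ) - t)) := fun s hs => by
      rw [hS.eq t htC s (by linarith), hhH]
      ring
    have hσval : ∀ s : unitInterval, |(s : ℝ) - t| ≤ η / 2 → σ t * (g s - h s - K t) =
        σ t * (g s - f₁ s) + (2 * L + 2) * ((s : ℝ) - t) := fun s hs => by
      linear_combination σ t * hval s hs + (2 * L + 2) * ((s : ℝ) - t) * hσ2
    refine existsUnique_mem_cr (σ := σ t) (k := K t) (half_pos hη) ?_ ?_ ?_ ?_ ?_
    · exact (Icc_subset_Icc (by linarith) (by linarith)).trans (hS.sub t htC)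
    · intro s s' hlt hs hs'
      have h1 := hslope t htC s s' hlt.le hs hs'
      have h2 : |σ t * (h s' - h s)| ≤ L * ((s' : ℝ) - s) := by
        rw [abs_mul, hcr.abs_sign, one_mul]
        exact hLip h hh s s' hlt.le
      have h3 : (s : ℝ) < s' := hlt
      linarith [(abs_le.1 h2).2]
    · intro s hs
      have h1 : |f₁ s - h s - K t| ≤ (2 * L + 2) * (η / 2) := by
        rw [hval s hs, abs_mul, hcr.abs_sign, one_mul, abs_mul, abs_of_pos (by linarith)]
        exact mul_le_mul_of_nonneg_left hs (by linarith)
      have h2 := abs_le.1 h1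
      have h3 := abs_lt.1 (hg s)
      have h4 := hS.small
      rw [abs_lt]
      constructor <;> linarith [h2.1, h2.2, h3.1, h3.2]
    · intro s hs
      have hst : (s : ℝ) - t = -(η / 2) := by linarith
      rw [hσval s (by rw [hst, abs_neg, abs_of_pos (by linarith)]), hst]
      linarith [(abs_lt.1 (hσg s)).2]
    · intro s hs
      have hst : (s : ℝ) - t = η / 2 := by linarith
      rw [hσval s (by rw [hst, abs_of_pos (by linarith)]), hst]
      linarith [(abs_lt.1 (hσg s)).1]
  -- Outside all windows a crossing of `g` would give `ρ ≤ intDist (f₁ s - h s) ≤ |g s - f₁ s| < ρ`.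
  · by_contra! hfar
    obtain ⟨k, hk⟩ := mem_cr_iff.1 hs
    have h1 := hρ h hh s fun t ht => (hfar t ht).le
    have h2 := intDist_le (f₁ s - h s) k
    have h3 : |f₁ s - h s - k| = |g s - f₁ s| := by
      rw [← hk, abs_sub_comm]
      congr 1
      ring
    linarith [hg s]

end SteepModification

/-- The box of parameters all of whose members yield smooth approximations of `f`. -/
theorem exists_gridBox_isSmoothApprox {F : Set C01} (hF : F.Finite)
    (hFL : ∀ h ∈ F, ∃ M : NNReal, LipschitzWith M h) {f : C01} (hfF : f ∉ F)
    (hT : Transverse (insert f F)) {ε : ℝ} (hε : 0 < ε) :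
    ∃ (n : ℕ) (b : ℕ → ℝ), ∃ δ > 0, ∀ p ∈ gridBox n b δ, IsSmoothApprox ε F f (plFun p) := by
  obtain ⟨M, hM⟩ : ∃ M : NNReal, ∀ h ∈ F, LipschitzWith M h := by
    choose! M hM using hFL
    exact ⟨hF.toFinset.sup M, fun h hh =>
      (hM h hh).weaken (Finset.le_sup (hF.mem_toFinset.2 hh))⟩
  have hLip : ∀ h ∈ F, ∀ s s' : unitInterval, s ≤ s' →
      |h s' - h s| ≤ (M : ℝ) * ((s' : ℝ) - s) := by
    intro h hh s s' hss
    have := (hM h hh).dist_le_mul s' s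
    rwa [Real.dist_eq, Subtype.dist_eq, Real.dist_eq,
      abs_of_nonneg (sub_nonneg.2 (show (s : ℝ) ≤ s' from hss))] at this
  obtain ⟨f₁, H, K, σ, η, hS⟩ := exists_steepModification hF hfF hT M.2 hε
  obtain ⟨ρ, hρ, happrox⟩ := hS.exists_isSmoothApprox hF
    (fun h hh => hT.finite_cr f (mem_insert _ _) h (mem_insert_of_mem _ hh)
      fun e => hfF (e ▸ hh)) M.2 hε hLip
  obtain ⟨n, δ, hδ, hbox⟩ := exists_gridBox_approx f₁ hρ (crossings f F) σ
    (fun t ht => (hS.crossing t ht).abs_sign) M.2 (half_lt_self hS.pos)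
    fun t ht s s' hss hs hs' => hS.slope_le hLip ht hss hs hs'
  exact ⟨n, _, δ, hδ, fun p hp => happrox _ (hbox p hp).1 (hbox p hp).2⟩

/-! ### The random sequence visits every box -/

theorem gridBox_eq_prod (n : ℕ) (b : ℕ → ℝ) (δ : ℝ) :
    gridBox n b δ = {n} ×ˢ
      (((Finset.Icc 1 n : Finset ℕ) : Set ℕ).pi (fun i => Metric.ball (gridPoint n i) δ) ×ˢ
        ((Finset.range (n + 2) : Finset ℕ) : Set ℕ).pi fun i => Metric.ball (b i) δ) := by
  ext ⟨m, x, y⟩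
  simp only [gridBox, mem_ofPred_eq, mem_prod, mem_singleton_iff, Set.mem_pi, Finset.coe_Icc,
    Finset.coe_range, mem_Icc, mem_Iio, Metric.mem_ball, Subtype.dist_eq, Real.dist_eq]
  refine and_congr_right fun _ => and_congr_left fun _ => ⟨fun h i hi => ?_, fun h i hi => ?_⟩
  · obtain ⟨j, rfl⟩ : ∃ j, i = j + 1 := ⟨i - 1, by omega⟩
    exact h j (by omega)
  · exact h (i + 1) ⟨by omega, by omega⟩

theorem measurableSet_gridBox (n : ℕ) (b : ℕ → ℝ) (δ : ℝ) : MeasurableSet (gridBox n b δ) := by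
  rw [gridBox_eq_prod]
  exact (measurableSet_singleton n).prod ((MeasurableSet.pi (Finset.countable_toSet _)
    fun _ _ => Metric.isOpen_ball.measurableSet).prod (MeasurableSet.pi (Finset.countable_toSet _)
    fun _ _ => Metric.isOpen_ball.measurableSet))

theorem volume_ball_unitInterval_ne_zero (c : unitInterval) {δ : ℝ} (hδ : 0 < δ) :
    (volume : Measure unitInterval) (Metric.ball c δ) ≠ 0 := by
  intro h
  rw [unitInterval.volume_apply] at h
  have hsub : Ioo (max 0 ((c : ℝ) - δ)) (min 1 (c + δ)) ⊆ Subtype.val '' Metric.ball c δ := by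
    rintro s ⟨h1, h2⟩
    rw [max_lt_iff] at h1
    rw [lt_min_iff] at h2
    refine ⟨⟨s, h1.1.le, h2.1.le⟩, ?_, rfl⟩
    rw [Metric.mem_ball, Subtype.dist_eq, Real.dist_eq, abs_lt]
    constructor <;> linarith
  have h0 := measure_mono_null hsub h
  rw [Real.volume_Ioo, ENNReal.ofReal_eq_zero, sub_nonpos] at h0
  have h3 : max 0 ((c : ℝ) - δ) < min 1 (c + δ) :=
    max_lt (lt_min one_pos (by linarith [c.2.1])) (lt_min (by linarith [c.2.2]) (by linarith))
  exact h3.not_ge h0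

theorem gaussianReal_ball_ne_zero (c : ℝ) {δ : ℝ} (hδ : 0 < δ) :
    gaussianReal 0 1 (Metric.ball c δ) ≠ 0 := fun h =>
  (Metric.measure_ball_pos volume c hδ).ne' (gaussianReal_absolutelyContinuous' 0 one_ne_zero h)

theorem paramMeasure_gridBox_ne_zero (n : ℕ) (b : ℕ → ℝ) {δ : ℝ} (hδ : 0 < δ) :
    paramMeasure (gridBox n b δ) ≠ 0 := by
  rw [gridBox_eq_prod, paramMeasure, Measure.prod_prod, Measure.prod_prod,
    Measure.infinitePi_pi _ fun _ _ => Metric.isOpen_ball.measurableSet,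
    Measure.infinitePi_pi _ fun _ _ => Metric.isOpen_ball.measurableSet]
  refine mul_ne_zero ?_ (mul_ne_zero (Finset.prod_ne_zero_iff.2 fun i _ =>
    volume_ball_unitInterval_ne_zero _ hδ) (Finset.prod_ne_zero_iff.2 fun i _ =>
    gaussianReal_ball_ne_zero _ hδ))
  intro h
  have := poissonMeasure_real_singleton_pos (r := 1) n one_pos
  rw [measureReal_def, h] at this
  simp at this

/-- Boxes with rational centres and radii `1 / (N + 1)` are countably many, and each given box
contains one of them. -/
theorem ae_exists_mem_gridBox : ∀ᵐ p ∂paramSeqMeasure, ∀ (n : ℕ) (b : ℕ → ℝ) (δ : ℝ), 0 < δ →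
    ∃ l, p l ∈ gridBox n b δ := by
  have hcount : ∀ᵐ p ∂paramSeqMeasure, ∀ (n N : ℕ) (b : Fin (n + 2) → ℚ),
      ∃ l, p l ∈ gridBox n (fun i => if h : i < n + 2 then (b ⟨i, h⟩ : ℝ) else 0)
        (1 / ((N : ℝ) + 1)) := by
    simp only [ae_all_iff]
    exact fun n N b => ae_exists_mem_of_measure_ne_zero _ (measurableSet_gridBox _ _ _)
      (paramMeasure_gridBox_ne_zero _ _ (by positivity))
  filter_upwards [hcount] with p hp n b δ hδ
  obtain ⟨N, hN⟩ := exists_nat_one_div_lt (half_pos hδ)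
  have hq : ∀ i : Fin (n + 2), ∃ q : ℚ, |(q : ℝ) - b i| < δ / 2 := fun i => by
    obtain ⟨q, hq1, hq2⟩ := exists_rat_btwn (show b i - δ / 2 < b i + δ / 2 by linarith)
    exact ⟨q, abs_lt.2 ⟨by linarith, by linarith⟩⟩
  choose q hq using hq
  obtain ⟨l, h1, h2, h3⟩ := hp n N q
  refine ⟨l, h1, fun i hi => (h2 i hi).trans (by linarith), fun i hi => ?_⟩
  have h4 := abs_lt.1 (h3 i hi)
  have h5 := abs_lt.1 (hq ⟨i, hi⟩)
  simp only [dif_pos hi] at h4 h5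
  rw [abs_lt]
  constructor <;> linarith [h4.1, h4.2, h5.1, h5.2]

/-! ### Smooth density of the random sequence -/

theorem isSmoothlyDense_of_transverse_of_forall_gridBox {p : ℕ → Param}
    (hT : Transverse (range fun i => plFun (p i)))
    (hp : ∀ (n : ℕ) (b : ℕ → ℝ) (δ : ℝ), 0 < δ → ∃ l, p l ∈ gridBox n b δ) :
    IsSmoothlyDense (range fun i => plFun (p i)) := by
  have happrox : ∀ F : Set C01, F.Finite → F ⊆ range (fun i => plFun (p i)) → ∀ f : C01, f ∉ F →
      Transverse (insert f F) → ∀ ε : ℝ, 0 < ε →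
      ∃ g ∈ range (fun i => plFun (p i)), IsSmoothApprox ε F f g := by
    intro F hF hFV f hfF hTF ε hε
    obtain ⟨n, b, δ, hδ, hbox⟩ := exists_gridBox_isSmoothApprox hF
      (fun h hh => by
        obtain ⟨i, rfl⟩ := hFV hh
        exact exists_lipschitzWith_plFun (p i)) hfF hTF hε
    obtain ⟨l, hl⟩ := hp n b δ hδ
    exact ⟨_, mem_range_self l, hbox _ hl⟩
  refine ⟨countable_range _, ?_, hT, ?_, happrox⟩
  · rw [Metric.dense_iff]
    intro f ε hε
    -- A singleton is vacuously transverse, so density is the case of an empty family.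
    have hTf : Transverse (insert f (∅ : Set C01)) := by
      constructor <;> simp +contextual
    obtain ⟨g, hg, hfg, -⟩ := happrox ∅ finite_empty (empty_subset _) f (notMem_empty f) hTf ε hε
    refine ⟨g, ?_, hg⟩
    rwa [Metric.mem_ball, dist_comm, dist_eq_norm]
  · rintro _ ⟨i, rfl⟩
    exact exists_lipschitzWith_plFun (p i)

theorem ae_isSmoothlyDense_range :
    ∀ᵐ f : ℕ → C01 ∂(Measure.infinitePi fun _ : ℕ => plMeasure), IsSmoothlyDense (range f) := by
  have : TopologicalSpace.IsCompletelyMetrizableSpace Param := inferInstance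
  have : PolishSpace (ℕ → Param) := inferInstance
  rw [← map_paramSeqMeasure]
  refine ae_map_of_ae paramSeqMeasure
    (measurable_pi_lambda _ fun i => measurable_plFun.comp (measurable_pi_apply i)) ?_
  filter_upwards [ae_transverse_range, ae_exists_mem_gridBox] with p h1 h2
  exact isSmoothlyDense_of_transverse_of_forall_gridBox h1 h2

end SmoothlyDense

theorem mainTheorem3 :
    ∀ᵐ f : ℕ → SmoothlyDense.C01 ∂(MeasureTheory.Measure.infinitePi
        (fun _ : ℕ => SmoothlyDense.plMeasure)),
      SmoothlyDense.IsSmoothlyDense (Set.range f) :=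
  SmoothlyDense.ae_isSmoothlyDense_range
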